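/- Let $p$ be a prime, $d\ge 1$ and $m\ge 0$ integers, and let $\tilde\Lambda$ be a (commutative) finite flat local $\mathbb Z_p$-algebra with maximal ideal $\tilde{\mathfrak m}$. Write $\tilde\Lambda\langle T\rangle$ for the $\tilde{\mathfrak m}$-adic completion of $\tilde\Lambda[T]$, i.e. the ring of power series over $\tilde\Lambda$ whose coefficients tend to $0$. Let $(\tilde r_{ij})$ be an $m\times m$ matrix of elements of $(z_1\cdots z_d)\tilde\Lambda[z_1,\dots,z_d]$, and let $u$ be an integer such that $(p-1)u$ is greater than the total degree of each $\tilde r_{ij}$ (where the zero polynomial is given degree $0$). Let $\hat{\mathbb P}^d$ be the formal projective space over $\mathbb Z_p$ with homogeneous coordinates $Z_0,\dots,Z_d$, let $z_i=Z_i/Z_0$, let $F$ be the lift of Frobenius $Z_i\mapsto Z_i^p$, and let $\mathcal O(-1)$ be the ideal sheaf of the hyperplane $Z_0=0$. Then $(\tilde r_{ij})\circ F^*$ is a $\tilde\Lambda$-linear endomorphism of the sheaf $\tilde\Lambda\otimes_{\mathbb Z_p}\mathcal O(-u)^m$, and $H^d(\mathbb P^d,\tilde\Lambda\otimes_{\mathbb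 Z_p}\mathcal O(-u)^m)$ is a finite free $\tilde\Lambda$-module. Put $$P(T)=\det\nolimits_{\tilde\Lambda}\bigl(1-H^d((\tilde r_{ij})\circ F^*)\,T,\ H^d(\mathbb P^d,\tilde\Lambda\otimes_{\mathbb Z_p}\mathcal O(-u)^m)\bigr)\in 1+T\tilde\Lambda[T].$$ Let $|\mathbb G_m^d|$ be the set of closed points of $\mathbb G_m^d=\operatorname{Spec}\mathbb F_p[z_1^{\pm1},\dots,z_d^{\pm1}]$. For $x\in|\mathbb G_m^d|$ let $\kappa(x)$ be the residue field, $d(x)=[\kappa(x):\mathbb F_p]$, $W_x=W(\kappa(x))$ the ring of Witt vectors with its Frobenius automorphism $\sigma$ (extended to $\tilde\Lambda\otimes_{\mathbb Z_p}W_x$ as $1\otimes\sigma$), and $\tilde x$ the Teichmüller lift of $x$, whose coordinates are the Teichmüller representatives in $W_x$ of the coordinates of $x$. Then $((\tilde r_{ij}(\tilde x))\circ\sigma)^{d(x)}$ is a $\tilde\Lambda\otimes_{\mathbb Z_p}W_x$-linear endomorphism of $(\tilde\Lambda\otimes_{\mathbb Z_p}W_x)^m$, and the determinant $$\det\nolimits_{\tilde\Lambda\otimes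 W_x}\bigl(1-((\tilde r_{ij}(\tilde x))\circ\sigma)^{d(x)}T^{d(x)},\ (\tilde\Lambda\otimes_{\mathbb Z_p} W_x)^m\bigr)$$ has coefficients in the subring $\tilde\Lambda$ of $\tilde\Lambda\otimes_{\mathbb Z_p}W_x$. The following product converges $T$-adically in $1+T\tilde\Lambda[[T]]$, and $$\prod_{x\in|\mathbb G_m^d|}\det\nolimits_{\tilde\Lambda\otimes W_x}\bigl(1-((\tilde r_{ij}(\tilde x))\circ\sigma)^{d(x)}T^{d(x)},\ (\tilde\Lambda\otimes_{\mathbb Z_p} W_x)^m\bigr)^{-1}=\prod_{i=0}^d P(p^iT)^{(-1)^{d+1-i}\binom di}.$$ In particular, the ratio of the left-hand side to $P(T)^{(-1)^{d+1}}$ lies in $1+pT\tilde\Lambda\langle T\rangle$ and is a rational function (a quotient $A/B$ of polynomials $A,B\in\tilde\Lambda[T]$ with $B(0)=1$). -/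

import Mathlib

open scoped TensorProduct

noncomputable section

namespace UnitLFunction

/-! ### Determinants `det(1 - f T)` and power series -/

/-- `det_R (1 - f T, M) ∈ R[T]`, for an endomorphism `f` of a finite free `R`-module `M`: the
determinant of the endomorphism `1 - T f` of the finite free `R[T]`-module `R[T] ⊗ M`. -/
def detOneSub {R M : Type*} [CommRing R] [AddCommGroup M] [Module R M] (f : M →ₗ[R] M) :
    Polynomial R :=
  LinearMap.det (1 - (Polynomial.X : Polynomial R) • f.baseChange (Polynomial R))

/-- The (possibly infinite) product `∏ f i` of power series converges to `L` for the `T`-adic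
topology of `R⟦T⟧`, i.e. the product topology over the discrete topology of `R`. -/
def HasTadicProd {ι R : Type*} [CommRing R] (f : ι → PowerSeries R) (L : PowerSeries R) : Prop :=
  @HasProd (PowerSeries R) ι _ (@PowerSeries.WithPiTopology.instTopologicalSpace R ⊥) f L
    (SummationFilter.unconditional ι)

/-- `g ∈ R⟨T⟩`, the `𝔪`-adic completion of `R[T]` (for a complete local ring `R`): the
coefficients of the power series `g` tend to zero `𝔪`-adically. -/
def IsRestricted {R : Type*} [CommRing R] [IsLocalRing R] (g : PowerSeries R) : Prop :=
  ∀ N : ℕ, ∀ᶠ n in Filter.atTop, PowerSeries.coeff n g ∈ IsLocalRing.maximalIdeal R ^ N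

/-! ### Cohomology of `Λ ⊗ 𝒪(-u)` on the formal projective space -/

section Cohomology

variable (p d m : ℕ) (Λ : Type*) [CommRing Λ] (u : ℤ)

/-- Sections of `Λ ⊗ 𝒪(-u)` over the formal affine open `{Z_i ≠ 0 for all i ∈ S}` (`S ≠ ∅`) of the
formal projective space of dimension `d` over `ℤ_p` with homogeneous coordinates `Z_0, …, Z_d`.

Here `𝒪(-1)` is the ideal sheaf of the hyperplane `Z_0 = 0`, and `Λ` is a finite flat
`ℤ_p`-algebra. With `z_j = Z_j / Z_0`, a section is a Laurent series `∑ a_n z^n`, `n ∈ ℤ^d`, with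
coefficients in `Λ` tending to zero `p`-adically, supported on those monomials
`z^n = Z_0 ^ (-∑ n_j) * ∏ Z_j ^ n_j` which are regular along `Z_j = 0` for all `j ≥ 1` outside `S`,
and which vanish to order at least `u` along `Z_0 = 0` if `0 ∉ S`. -/
def sections (S : Finset (Fin (d + 1))) : Submodule Λ ((Fin d → ℤ) → Λ) where
  carrier := {a | (∀ N : ℕ, {n | a n ∉ Ideal.span {(p : Λ) ^ N}}.Finite) ∧
    ∀ n, a n ≠ 0 → (∀ j : Fin d, j.succ ∉ S → 0 ≤ n j) ∧ (0 ∉ S → u ≤ -∑ j, n j)}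
  add_mem' := by
    rintro a b ⟨ha, ha'⟩ ⟨hb, hb'⟩
    refine ⟨fun N => ((ha N).union (hb N)).subset fun n hn => ?_, fun n hn => ?_⟩
    · by_contra h
      simp only [Set.mem_union, Set.mem_ofPred_eq, not_or, not_not] at h
      exact hn (add_mem h.1 h.2)
    · by_cases h : a n = 0
      · exact hb' n fun h' => hn (by simp [h, h'])
      · exact ha' n h
  zero_mem' := by simp
  smul_mem' := by
    rintro c a ⟨ha, ha'⟩
    refine ⟨fun N => (ha N).subset fun n hn h => hn ?_, fun n hn => ha' n fun h => hn ?_⟩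
    · exact Ideal.mul_mem_left _ _ h
    · simp [h]

variable {Λ u} in
theorem sections_mono {S S' : Finset (Fin (d + 1))} (h : S ⊆ S') :
    sections p d Λ u S ≤ sections p d Λ u S' :=
  fun _ ha => ⟨ha.1, fun n hn => ⟨fun j hj => (ha.2 n hn).1 j fun h' => hj (h h'),
    fun h0 => (ha.2 n hn).2 fun h' => h0 (h h')⟩⟩

/-- Families, indexed by the `(k + 1)`-element subsets `S = {i_0 < ⋯ < i_k}` of `{0, …, d}`, of
`m`-tuples of arbitrary formal Laurent series. -/
abbrev Family (k : ℕ) : Type _ :=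
  {S : Finset (Fin (d + 1)) // S.card = k + 1} → Fin m → (Fin d → ℤ) → Λ

/-- The module of Čech `k`-cochains of `Λ ⊗ 𝒪(-u)^m` for the standard covering by the `d + 1` formal
affine opens `Z_i ≠ 0`: the families of sections of `Λ ⊗ 𝒪(-u)^m` over the intersections
`{Z_i ≠ 0 for all i ∈ S}`. -/
def cochains (k : ℕ) : Submodule Λ (Family d m Λ k) where
  carrier := {c | ∀ S : {S : Finset (Fin (d + 1)) // S.card = k + 1}, ∀ l,
    c S l ∈ sections p d Λ u S.1}
  add_mem' ha hb S l := add_mem (ha S l) (hb S l)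
  zero_mem' _ _ := zero_mem _
  smul_mem' c _ ha S l := Submodule.smul_mem _ c (ha S l)

/-- The Čech differential `(δ c)(i_0 < ⋯ < i_(k+1)) = ∑_s (-1)^s c(i_0 < ⋯ î_s ⋯ < i_(k+1))`;
the exponent `s` is the number of elements of `S` that are smaller than `i = i_s`. The restriction
maps do not appear, since they are inclusions of modules of Laurent series. -/
def differential (k : ℕ) : Family d m Λ k →ₗ[Λ] Family d m Λ (k + 1) where
  toFun c S l := ∑ i : S.1, (-1 : Λ) ^ (S.1.filter (· < i.1)).card •
    c ⟨S.1.erase i.1, by rw [Finset.card_erase_of_mem i.2, S.2]; rfl⟩ l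
  map_add' a b := by
    ext S l n
    simp [Finset.sum_add_distrib]
  map_smul' c a := by
    ext S l n
    simp [Finset.mul_sum, mul_left_comm c]

variable {p d m Λ u} in
/-- The differential maps cochains to cochains. -/
theorem differential_mem {k : ℕ} {c : Family d m Λ k} (hc : c ∈ cochains p d m Λ u k) :
    differential d m Λ k c ∈ cochains p d m Λ u (k + 1) :=
  fun S l => Submodule.sum_mem _ fun i _ => Submodule.smul_mem _ _
    (sections_mono p d (S.1.erase_subset i.1) (hc _ l))

/-- The Čech `k`-cocycles of `Λ ⊗ 𝒪(-u)^m`. -/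
def cocycles (k : ℕ) : Submodule Λ (Family d m Λ k) :=
  cochains p d m Λ u k ⊓ LinearMap.ker (differential d m Λ k)

/-- The Čech `k`-coboundaries of `Λ ⊗ 𝒪(-u)^m`. -/
def coboundaries : (k : ℕ) → Submodule Λ (Family d m Λ k)
  | 0 => ⊥
  | k + 1 => (cochains p d m Λ u k).map (differential d m Λ k)

/-- `H^k(ℙ^d, Λ ⊗ 𝒪(-u)^m)` on the formal projective space, as the cohomology of the Čech complex
of the standard affine covering: cocycles modulo coboundaries. -/
abbrev cohomology (k : ℕ) : Type _ :=
  cocycles p d m Λ u k ⧸ (coboundaries p d m Λ u k).submoduleOf (cocycles p d m Λ u k)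

end Cohomology

/-! ### The endomorphism of `H^k(ℙ^d, Λ ⊗ 𝒪(-u)^m)` induced by `(r_ij) ∘ F^*` -/

section Frobenius

variable {p d m : ℕ} [hp : Fact p.Prime] {Λ : Type*} [CommRing Λ] {u : ℤ}

/-- `F^*` on Laurent series: `∑ a_n z^n ↦ ∑ a_n z^(p n)`. -/
def frobPullback (p : ℕ) (a : (Fin d → ℤ) → Λ) : (Fin d → ℤ) → Λ :=
  fun n => if ∀ j, (p : ℤ) ∣ n j then a (fun j => n j / p) else 0

/-- Multiplication of a Laurent series by a polynomial in `z_1, …, z_d`. -/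
def polyMul (f : MvPolynomial (Fin d) Λ) (a : (Fin d → ℤ) → Λ) : (Fin d → ℤ) → Λ :=
  fun n => ∑ α ∈ f.support, f.coeff α * a (fun j => n j - α j)

theorem polyMul_frobPullback_mem {f : MvPolynomial (Fin d) Λ}
    (hf : (f.totalDegree : ℤ) < (p - 1) * u) {S : Finset (Fin (d + 1))} {a : (Fin d → ℤ) → Λ}
    (ha : a ∈ sections p d Λ u S) : polyMul f (frobPullback p a) ∈ sections p d Λ u S := by
  have hp' : (p : ℤ) ≠ 0 := by exact_mod_cast hp.out.ne_zero
  refine ⟨fun N => ?_, fun n hn => ?_⟩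
  · refine (Set.Finite.biUnion f.support.finite_toSet
      (t := fun α => (fun k : Fin d → ℤ => fun j => p * k j + α j) ''
        {k | a k ∉ Ideal.span {(p : Λ) ^ N}}) fun α _ => (ha.1 N).image _).subset ?_
    intro n hn
    by_contra h
    refine hn (Submodule.sum_mem _ fun α hα => Ideal.mul_mem_left _ _ ?_)
    by_contra h'
    unfold frobPullback at h'
    split_ifs at h' with hd
    · refine h (Set.mem_biUnion (Finset.mem_coe.2 hα) ⟨_, h', ?_⟩)
      funext j
      simp only [Int.mul_ediv_cancel' (hd j)]
      ring
    · exact h' (zero_mem _)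
  · obtain ⟨α, hα, h⟩ := Finset.exists_ne_zero_of_sum_ne_zero hn
    have h' : frobPullback p a (fun j => n j - α j) ≠ 0 := fun h0 => h (by simp [h0])
    unfold frobPullback at h'
    split_ifs at h' with hd
    · have key : ∀ j, n j = p * ((n j - α j) / p) + α j := fun j => by
        rw [Int.mul_ediv_cancel' (hd j)]; ring
      obtain ⟨h1, h2⟩ := ha.2 _ h'
      refine ⟨fun j hj => ?_, fun h0 => ?_⟩
      · rw [key j]
        have := h1 j hj
        positivity
      · have h3 := h2 h0
        have hdeg : (∑ j, (α j : ℤ)) ≤ f.totalDegree := by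
          have := MvPolynomial.le_totalDegree hα
          rw [Finsupp.sum_fintype _ _ (fun _ => rfl)] at this
          exact_mod_cast this
        rw [Finset.sum_congr rfl fun j _ => key j, Finset.sum_add_distrib, ← Finset.mul_sum]
        have hp0 : (0 : ℤ) ≤ p := by positivity
        nlinarith [mul_le_mul_of_nonneg_left h3 hp0]
    · exact absurd rfl h'

/-- `f ∘ F^*` on Laurent series, for a polynomial `f`. -/
def mulFrob (p : ℕ) (f : MvPolynomial (Fin d) Λ) : ((Fin d → ℤ) → Λ) →ₗ[Λ] ((Fin d → ℤ) → Λ) where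
  toFun a := polyMul f (frobPullback p a)
  map_add' a b := by
    ext n
    simp only [polyMul, frobPullback, Pi.add_apply, ← Finset.sum_add_distrib, ← mul_add]
    refine Finset.sum_congr rfl fun α _ => ?_
    split_ifs <;> simp
  map_smul' c a := by
    ext n
    simp only [polyMul, frobPullback, Pi.smul_apply, smul_eq_mul, RingHom.id_apply, Finset.mul_sum]
    refine Finset.sum_congr rfl fun α _ => ?_
    split_ifs
    · ring
    · simp

/-- `(r_ij) ∘ F^*` on families of `m`-tuples of Laurent series: on each member of the family, it is
`v ↦ (∑_j r_ij F^*(v_j))_i`. -/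
def familyMap (p : ℕ) (r : Matrix (Fin m) (Fin m) (MvPolynomial (Fin d) Λ)) (k : ℕ) :
    Family d m Λ k →ₗ[Λ] Family d m Λ k where
  toFun c S i := ∑ j, mulFrob p (r i j) (c S j)
  map_add' a b := by
    ext S i n
    simp [Finset.sum_add_distrib]
  map_smul' c a := by
    ext S i n
    simp [Finset.mul_sum]

/-- If the polynomials `r_ij` have degree less than `(p - 1) u`, then `(r_ij) ∘ F^*` maps cochains of
`Λ ⊗ 𝒪(-u)^m` to cochains of `Λ ⊗ 𝒪(-u)^m`. -/
theorem familyMap_mem {r : Matrix (Fin m) (Fin m) (MvPolynomial (Fin d) Λ)}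
    (hr : ∀ i j, ((r i j).totalDegree : ℤ) < (p - 1) * u) {k : ℕ} {c : Family d m Λ k}
    (hc : c ∈ cochains p d m Λ u k) : familyMap p r k c ∈ cochains p d m Λ u k :=
  fun S i => Submodule.sum_mem (t := Finset.univ) (f := fun j => mulFrob p (r i j) (c S j)) _
    fun j _ => polyMul_frobPullback_mem (hr i j) (hc S j)

theorem differential_familyMap (p : ℕ) (r : Matrix (Fin m) (Fin m) (MvPolynomial (Fin d) Λ))
    (k : ℕ) (c : Family d m Λ k) :
    differential d m Λ k (familyMap p r k c) = familyMap p r (k + 1) (differential d m Λ k c) := by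
  funext S i
  simp only [differential, familyMap, LinearMap.coe_mk, AddHom.coe_mk, map_sum, map_smul,
    Finset.smul_sum]
  exact Finset.sum_comm

theorem familyMap_mem_cocycles {r : Matrix (Fin m) (Fin m) (MvPolynomial (Fin d) Λ)}
    (hr : ∀ i j, ((r i j).totalDegree : ℤ) < (p - 1) * u) {k : ℕ} {c : Family d m Λ k}
    (hc : c ∈ cocycles p d m Λ u k) : familyMap p r k c ∈ cocycles p d m Λ u k := by
  refine ⟨familyMap_mem hr hc.1, ?_⟩
  have h : differential d m Λ k c = 0 := hc.2
  change differential d m Λ k (familyMap p r k c) = 0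
  rw [differential_familyMap, h, map_zero]

theorem familyMap_mem_coboundaries {r : Matrix (Fin m) (Fin m) (MvPolynomial (Fin d) Λ)}
    (hr : ∀ i j, ((r i j).totalDegree : ℤ) < (p - 1) * u) {k : ℕ} {c : Family d m Λ k}
    (hc : c ∈ coboundaries p d m Λ u k) : familyMap p r k c ∈ coboundaries p d m Λ u k := by
  cases k with
  | zero =>
    have h : c = 0 := hc
    rw [h, map_zero]
    exact zero_mem _
  | succ k =>
    obtain ⟨b, hb, rfl⟩ := hc
    exact ⟨familyMap p r k b, familyMap_mem hr hb, differential_familyMap p r k b⟩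

/-- `H^k((r_ij) ∘ F^*)`, the `Λ`-linear endomorphism of `H^k(ℙ^d, Λ ⊗ 𝒪(-u)^m)` induced by
`(r_ij) ∘ F^*`, for polynomials `r_ij` of degree less than `(p - 1) u`. -/
def cohomologyMap (r : Matrix (Fin m) (Fin m) (MvPolynomial (Fin d) Λ))
    (hr : ∀ i j, ((r i j).totalDegree : ℤ) < (p - 1) * u) (k : ℕ) :
    cohomology p d m Λ u k →ₗ[Λ] cohomology p d m Λ u k :=
  Submodule.mapQ _ _
    ((familyMap p r k).restrict (p := cocycles p d m Λ u k) (q := cocycles p d m Λ u k)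
      fun _ hc => familyMap_mem_cocycles hr hc)
    fun _ hc => familyMap_mem_coboundaries hr hc

/-- The characteristic series
`P(T) = det_Λ (1 - H^d((r_ij) ∘ F^*) T, H^d(ℙ^d, Λ ⊗ 𝒪(-u)^m)) ∈ Λ[T]`. -/
def charSeries (r : Matrix (Fin m) (Fin m) (MvPolynomial (Fin d) Λ))
    (hr : ∀ i j, ((r i j).totalDegree : ℤ) < (p - 1) * u) : Polynomial Λ :=
  detOneSub (cohomologyMap r hr d)

end Frobenius

/-! ### Closed points of the torus, Witt vectors and Teichmüller lifts -/

section Points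

variable (p : ℕ) [hp : Fact p.Prime] (d : ℕ)

/-- The coordinate ring `𝔽_p[z_1, z_1⁻¹, …, z_d, z_d⁻¹]` of `𝔾_m^d`, as the group algebra of
`ℤ^d`. -/
abbrev TorusRing : Type := AddMonoidAlgebra (ZMod p) (Fin d → ℤ)

/-- The closed points of `𝔾_m^d` over `𝔽_p`. -/
abbrev ClosedPoint : Type := MaximalSpectrum (TorusRing p d)

variable {p d}

/-- The residue field `κ(x)`. -/
abbrev residue (x : ClosedPoint p d) : Type := TorusRing p d ⧸ x.asIdeal

instance instFieldResidue (x : ClosedPoint p d) : Field (residue x) := Ideal.Quotient.field x.asIdeal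

instance instCharPResidue (x : ClosedPoint p d) : CharP (residue x) p :=
  charP_of_injective_algebraMap (algebraMap (ZMod p) (residue x)).injective p

/-- The value `z_i(x) ∈ κ(x)`. -/
def coord (x : ClosedPoint p d) (i : Fin d) : residue x :=
  Ideal.Quotient.mk x.asIdeal (AddMonoidAlgebra.single (Pi.single i 1) 1)

/-- The degree `d(x)` of `κ(x)` over `𝔽_p`. -/
def deg (x : ClosedPoint p d) : ℕ := Module.finrank (ZMod p) (residue x)

instance instFiniteResidue (x : ClosedPoint p d) : Module.Finite (ZMod p) (residue x) := by
  have : AddMonoid.FG (Fin d → ℤ) := by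
    rw [← AddGroup.fg_iff_addMonoid_fg]
    exact Module.Finite.iff_addGroup_fg.1 inferInstance
  have : Algebra.FiniteType (ZMod p) (residue x) :=
    Algebra.FiniteType.of_surjective (Ideal.Quotient.mkₐ (ZMod p) x.asIdeal)
      (Ideal.Quotient.mkₐ_surjective _ _)
  exact finite_of_finite_type_of_isJacobsonRing _ _

/-- `W(k)` is an algebra over `ℤ_p = W(𝔽_p)`, for every `𝔽_p`-algebra `k`. -/
instance instAlgebraWitt {k : Type*} [CommRing k] [Algebra (ZMod p) k] : Algebra ℤ_[p] (WittVector p k) :=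
  ((WittVector.map (algebraMap (ZMod p) k)).comp
    (WittVector.equiv p).symm.toRingHom).toAlgebra

/-- The Frobenius automorphism `σ` of `W_x = W(κ(x))`, as a homomorphism of `ℤ_p`-algebras. -/
def wittFrob (x : ClosedPoint p d) :
    WittVector p (residue x) →ₐ[ℤ_[p]] WittVector p (residue x) where
  __ := (WittVector.frobenius : WittVector p (residue x) →+* WittVector p (residue x))
  commutes' c := by
    change WittVector.frobenius (WittVector.map _ ((WittVector.equiv p).symm c)) =
      WittVector.map _ ((WittVector.equiv p).symm c)
    ext n
    rw [WittVector.coeff_frobenius_charP, WittVector.map_coeff, ← map_pow, ZMod.pow_card]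

variable (Λ : Type*) [CommRing Λ] [Algebra ℤ_[p] Λ]

/-- The ring `Λ ⊗_{ℤ_p} W_x`. -/
abbrev WittTensor (x : ClosedPoint p d) : Type _ := Λ ⊗[ℤ_[p]] WittVector p (residue x)

/-- `σ = 1 ⊗ σ` on `Λ ⊗_{ℤ_p} W_x`. -/
def sigma (x : ClosedPoint p d) : WittTensor Λ x →+* WittTensor Λ x :=
  (Algebra.TensorProduct.map (AlgHom.id Λ Λ) (wittFrob x)).toRingHom

theorem wittFrob_iterate_deg (x : ClosedPoint p d) (w : WittVector p (residue x)) :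
    (wittFrob x)^[deg x] w = w := by
  have : Finite (residue x) := Module.finite_of_finite (ZMod p)
  have := Fintype.ofFinite (residue x)
  have hcard : Fintype.card (residue x) = p ^ deg x := by
    rw [Module.card_eq_pow_finrank (K := ZMod p), ZMod.card, deg]
  have h : ∀ (k : ℕ) (w : WittVector p (residue x)) (n : ℕ),
      ((wittFrob x)^[k] w).coeff n = w.coeff n ^ p ^ k := by
    intro k
    induction k with
    | zero => simp
    | succ k ih =>
      intro w n
      rw [Function.iterate_succ_apply, ih]
      change (WittVector.frobenius w).coeff n ^ p ^ k = _
      rw [WittVector.coeff_frobenius_charP, ← pow_mul, pow_succ']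
  ext n
  rw [h, ← hcard, FiniteField.pow_card]

variable {Λ}

theorem sigma_iterate_deg (x : ClosedPoint p d) (b : WittTensor Λ x) :
    (sigma Λ x)^[deg x] b = b := by
  have h : ∀ (k : ℕ) (a : Λ) (w : WittVector p (residue x)),
      (sigma Λ x)^[k] (a ⊗ₜ w) = a ⊗ₜ ((wittFrob x)^[k] w) := by
    intro k
    induction k with
    | zero => simp
    | succ k ih =>
      intro a w
      rw [Function.iterate_succ_apply, Function.iterate_succ_apply, ← ih]
      rfl
  induction b using TensorProduct.induction_on with
  | zero => exact iterate_map_zero (sigma Λ x) _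
  | tmul a w => rw [h, wittFrob_iterate_deg]
  | add b c hb hc => rw [iterate_map_add, hb, hc]

/-- The value `f(x̃) ∈ Λ ⊗_{ℤ_p} W_x` of a polynomial at the Teichmüller lift `x̃` of `x`, whose
coordinates are the Teichmüller representatives of the coordinates of `x`. -/
def evalTeich (x : ClosedPoint p d) (f : MvPolynomial (Fin d) Λ) : WittTensor Λ x :=
  MvPolynomial.aeval (fun i => (1 : Λ) ⊗ₜ[ℤ_[p]] WittVector.teichmuller p (coord x i)) f

/-- The `σ`-linear endomorphism `(r_ij(x̃)) ∘ σ` of `(Λ ⊗_{ℤ_p} W_x)^m`. -/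
def fibreFrob {m : ℕ} (r : Matrix (Fin m) (Fin m) (MvPolynomial (Fin d) Λ))
    (x : ClosedPoint p d) :
    (Fin m → WittTensor Λ x) →ₛₗ[sigma Λ x] (Fin m → WittTensor Λ x) where
  toFun v := (r.map (evalTeich x)).mulVec fun j => sigma Λ x (v j)
  map_add' v w := by
    rw [← Matrix.mulVec_add]
    congr 1
    funext j
    simp
  map_smul' c v := by
    rw [← Matrix.mulVec_smul]
    congr 1
    funext j
    simp

/-- The iterate `((r_ij(x̃)) ∘ σ)^{d(x)}`, which is `Λ ⊗_{ℤ_p} W_x`-linear because `σ^{d(x)} = 1`. -/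
def fibreFrobPow {m : ℕ} (r : Matrix (Fin m) (Fin m) (MvPolynomial (Fin d) Λ))
    (x : ClosedPoint p d) :
    (Fin m → WittTensor Λ x) →ₗ[WittTensor Λ x] (Fin m → WittTensor Λ x) where
  toFun := (fibreFrob r x)^[deg x]
  map_add' v w := iterate_map_add (fibreFrob r x) _ v w
  map_smul' c v := by
    have h : ∀ k : ℕ, (fibreFrob r x)^[k] (c • v) =
        (sigma Λ x)^[k] c • (fibreFrob r x)^[k] v := by
      intro k
      induction k with
      | zero => rfl
      | succ k ih => simp only [Function.iterate_succ_apply', ih, LinearMap.map_smulₛₗ]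
    rw [h, sigma_iterate_deg, RingHom.id_apply]

/-- `det (1 - ((r_ij(x̃)) ∘ σ)^{d(x)} T^{d(x)}, (Λ ⊗_{ℤ_p} W_x)^m)`, a polynomial with coefficients in
`Λ ⊗_{ℤ_p} W_x`. -/
def localDet {m : ℕ} (r : Matrix (Fin m) (Fin m) (MvPolynomial (Fin d) Λ))
    (x : ClosedPoint p d) : Polynomial (WittTensor Λ x) :=
  Polynomial.expand _ (deg x) (detOneSub (fibreFrobPow r x))

end Points

end UnitLFunction

end

/-!
The proof is Dwork's: both sides of the product formula have constant coefficient `1`, and `Λ` is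
torsion-free, so it is enough to compare the logarithmic derivatives `T F' / F`
(`coeff_eq_of_coeff_logDeriv_eq`). In degree `n`, both turn out to be `(p^n - 1)^d tr(A^n)`, for the
finite matrix `A` of `H^d(r ∘ F^*)`.

*Cohomology.* A top Čech cochain is a Laurent series, and the coboundaries are the series without
the monomials `z^(-k)`, `k ∈ expIndex d u`, that is `k_j ≥ 1` and `∑ k_j < u` (`ker_topCoeff`). So
`H^d` is free on these monomials, and the matrix `A` of `r ∘ F^*` consists of the coefficients
`r_(p k - l)` (`toMatrix_cohomologyMap`). The powers of `A` are given by the coefficients at `p^n k - l`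
of the product `R_n(z) = r(z) r(z^p) ⋯ r(z^(p^(n-1)))` (`dworkMatrix_pow_apply`). Divisibility by
`z_1 ⋯ z_d` and the degree bound confine the exponents to `expIndex d u`.

*Points.* Summing `R_n` over the Teichmüller points of the torus over `𝔽_q`, `q = p^n`, keeps the
coefficients with exponents divisible by `q - 1` and multiplies them by `(q - 1)^d`. This gives `(q - 1)^d tr(A^n)`
(`sum_trace_frobProd`). The point over a closed point `x` contributes the trace of a power of the
local Frobenius matrix. That trace, and the local determinant, are invariant under Frobenius because
it permutes the factors of `R_n` cyclically; as the invariants of `Λ ⊗ W_x` are `Λ`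
(`exists_of_wittTensorMap_frob_eq`), they lie in `Λ`. There are `d(x)` points over `x` if
`d(x) ∣ n`, and none otherwise, which is what the logarithmic derivative of the local determinant asks for
(`sum_coeff_logDeriv_localFactor`).

*Conclusion.* The exponents `(-1)^(d+1-i) (d choose i)` come from the binomial expansion of
`(q - 1)^d` (`sum_binomial_eq`). In the ratio, the factor `i = 0` cancels and the others are series in
`p T`; so the `n`-th coefficient is divisible by `p^n`, which yields the statement on `Λ⟨T⟩`
(`exists_isRestricted`).
-/

noncomputable section

namespace UnitLFunction

/-! ### Determinants and logarithmic derivatives -/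

theorem derivation_prod {R A ι : Type*} [CommRing R] [CommRing A] [Algebra R A] [DecidableEq ι]
    (D : Derivation R A A) (s : Finset ι) (f : ι → A) :
    D (∏ i ∈ s, f i) = ∑ i ∈ s, (∏ k ∈ s.erase i, f k) * D (f i) := by
  induction s using Finset.induction_on with
  | empty => simp
  | insert a s ha ih =>
    rw [Finset.prod_insert ha, D.leibniz, ih, Finset.sum_insert ha, Finset.erase_insert ha,
      smul_eq_mul, smul_eq_mul, Finset.mul_sum, add_comm]
    congr 1
    refine Finset.sum_congr rfl fun i hi => ?_
    have hai : a ≠ i := fun h => ha (h ▸ hi)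
    rw [Finset.erase_insert_of_ne hai, Finset.prod_insert fun h => ha (Finset.mem_of_mem_erase h),
      mul_assoc]

/-- Jacobi's formula for the derivative of a determinant. -/
theorem derivation_det {R A n : Type*} [CommRing R] [CommRing A] [Algebra R A] [Fintype n]
    [DecidableEq n] (D : Derivation R A A) (M : Matrix n n A) :
    D M.det = (M.adjugate * M.map D).trace := by
  have h : ∀ i, (M.adjugate * M.map D) i i =
      ∑ σ : Equiv.Perm n, Equiv.Perm.sign σ •
        ((∏ k ∈ Finset.univ.erase i, M (σ k) k) * D (M (σ i) i)) := fun i => by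
    have h1 : (M.adjugate * M.map D) i i = (M.updateCol i fun k => D (M k i)).det := by
      rw [← Matrix.cramer_apply, Matrix.cramer_eq_adjugate_mulVec]
      rfl
    rw [h1, Matrix.det_apply]
    refine Finset.sum_congr rfl fun σ _ => ?_
    rw [← Finset.prod_erase_mul _ _ (Finset.mem_univ i), Matrix.updateCol_self]
    congr 2
    exact Finset.prod_congr rfl fun k hk => Matrix.updateCol_ne (Finset.ne_of_mem_erase hk)
  simp only [Matrix.trace, Matrix.diag_apply, h]
  rw [Finset.sum_comm, Matrix.det_apply, map_sum]
  refine Finset.sum_congr rfl fun σ _ => ?_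
  rw [Derivation.map_smul_of_tower, ← Finset.smul_sum]
  congr 1
  exact derivation_prod D _ _

/-- The reversed characteristic polynomial in the variable `T ^ d`: the power series
`det (1 - M T ^ d)`. -/
def revCharpoly {R n : Type*} [CommRing R] [Fintype n] [DecidableEq n] (d : ℕ)
    (M : Matrix n n R) : PowerSeries R :=
  (1 - (PowerSeries.X ^ d : PowerSeries R) • M.map PowerSeries.C).det

/-- The identity `T (d/dT) log det (1 - M T ^ d) = -∑_{e ≥ 1} d tr(M ^ e) T ^ (d e)`, with
denominators cleared. -/
theorem X_mul_derivative_revCharpoly {R n : Type*} [CommRing R] [Fintype n] [DecidableEq n]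
    {d : ℕ} (hd : 0 < d) (M : Matrix n n R) :
    PowerSeries.X * PowerSeries.derivative R (revCharpoly d M) = -(revCharpoly d M *
      PowerSeries.mk fun k => if k ≠ 0 ∧ d ∣ k then (d : R) * (M ^ (k / d)).trace else 0) := by
  set N : Matrix n n (PowerSeries R) := (PowerSeries.X ^ d : PowerSeries R) • M.map PowerSeries.C
    with hN
  set G : Matrix n n (PowerSeries R) := Matrix.of fun i j =>
    PowerSeries.mk fun k => if k ≠ 0 ∧ d ∣ k then (M ^ (k / d)) i j else 0 with hG
  -- `G` is the geometric series `∑_{k ≥ 1} N ^ k`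
  have key : (1 - N) * G = N := by
    have hNG : ∀ i j, (N * G) i j = PowerSeries.X ^ d * ∑ l, PowerSeries.C (M i l) * G l j := by
      intro i j
      simp [hN, Matrix.mul_apply, Finset.mul_sum, mul_assoc]
    ext i j k
    rw [sub_mul, one_mul, Matrix.sub_apply, hNG]
    simp only [map_sub, PowerSeries.coeff_X_pow_mul', map_sum, PowerSeries.coeff_C_mul, hG,
      Matrix.of_apply, PowerSeries.coeff_mk, hN, Matrix.smul_apply, Matrix.map_apply, smul_eq_mul,
      PowerSeries.coeff_C]
    by_cases hdk : d ≤ k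
    · obtain ⟨e, rfl⟩ := Nat.exists_eq_add_of_le hdk
      simp only [hdk, if_true, Nat.add_sub_cancel_left]
      by_cases he : d ∣ e
      · obtain ⟨f, rfl⟩ := he
        have h1 : (d + d * f) / d = f + 1 := by
          rw [show d + d * f = d * (f + 1) by ring, Nat.mul_div_cancel_left _ hd]
        rcases Nat.eq_zero_or_pos f with rfl | hf
        · simp [hd.ne', Nat.div_self hd]
        · have h2 : d * f ≠ 0 := (Nat.mul_pos hd hf).ne'
          simp [hd.ne', hf.ne', h1, Nat.mul_div_cancel_left _ hd, pow_succ', Matrix.mul_apply]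
      · have h3 : e ≠ 0 := by rintro rfl; exact he (dvd_zero d)
        simp [he, h3]
    · have : ¬ (k ≠ 0 ∧ d ∣ k) := fun h => hdk (Nat.le_of_dvd (Nat.pos_of_ne_zero h.1) h.2)
      simp [hdk, this]
  have hder : (PowerSeries.X : PowerSeries R) • (1 - N).map (PowerSeries.derivative R) =
      -((d : PowerSeries R) • N) := by
    obtain ⟨e, rfl⟩ := Nat.exists_eq_succ_of_ne_zero hd.ne'
    ext1 i j
    have h0 : PowerSeries.derivative R ((1 : Matrix n n (PowerSeries R)) i j) = 0 := by
      rw [Matrix.one_apply]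
      split_ifs <;> simp
    simp only [Matrix.smul_apply, Matrix.map_apply, Matrix.sub_apply, map_sub, h0, hN, smul_eq_mul,
      Matrix.neg_apply, Derivation.leibniz, PowerSeries.derivative_pow, PowerSeries.derivative_C,
      PowerSeries.derivative_X, Nat.succ_eq_add_one, Nat.add_sub_cancel]
    ring
  -- the adjugate of `1 - N` is `det (1 - N)` times the inverse of `1 - N`
  have hadj : (1 - N).adjugate * N = (1 - N).det • G := by
    nth_rewrite 2 [← key]
    rw [← mul_assoc, Matrix.adjugate_mul, Matrix.smul_mul, one_mul]
  have htr : PowerSeries.mk (fun k => if k ≠ 0 ∧ d ∣ k then (d : R) * (M ^ (k / d)).trace else 0) =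
      (d : PowerSeries R) * G.trace := by
    ext k
    rw [← map_natCast (PowerSeries.C (R := R)), PowerSeries.coeff_C_mul]
    simp only [Matrix.trace, Matrix.diag_apply, hG, Matrix.of_apply, map_sum, PowerSeries.coeff_mk]
    split_ifs <;> simp
  rw [htr, revCharpoly, derivation_det, ← smul_eq_mul, ← Matrix.trace_smul, ← Matrix.mul_smul, hder,
    Matrix.mul_neg, Matrix.mul_smul, hadj, Matrix.trace_neg, Matrix.trace_smul, Matrix.trace_smul]
  simp only [smul_eq_mul]
  ring

theorem map_revCharpoly {R S n : Type*} [CommRing R] [CommRing S] [Fintype n] [DecidableEq n]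
    (φ : R →+* S) (d : ℕ) (M : Matrix n n R) :
    PowerSeries.map φ (revCharpoly d M) = revCharpoly d (M.map φ) := by
  rw [revCharpoly, RingHom.map_det, revCharpoly]
  congr 1
  ext1 i j
  rcases eq_or_ne i j with rfl | h
  · simp
  · simp [h]

theorem constantCoeff_revCharpoly {R n : Type*} [CommRing R] [Fintype n] [DecidableEq n]
    {d : ℕ} (hd : 0 < d) (M : Matrix n n R) :
    PowerSeries.constantCoeff (revCharpoly d M) = 1 := by
  rw [revCharpoly, RingHom.map_det, ← Matrix.det_one (n := n) (R := R)]
  congr 1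
  ext1 i j
  rcases eq_or_ne i j with rfl | h
  · simp [hd.ne']
  · simp [h, hd.ne']

theorem revCharpoly_mul_comm {R n : Type*} [CommRing R] [Fintype n] [DecidableEq n]
    (d : ℕ) (A B : Matrix n n R) : revCharpoly d (A * B) = revCharpoly d (B * A) := by
  have h : ∀ A B : Matrix n n R, (PowerSeries.X ^ d : PowerSeries R) • (A * B).map PowerSeries.C =
      (PowerSeries.X ^ d : PowerSeries R) • (A.map PowerSeries.C * B.map PowerSeries.C) :=
    fun A B => by rw [Matrix.map_mul]
  rw [revCharpoly, revCharpoly, h, h, ← Matrix.smul_mul, Matrix.det_one_sub_mul_comm,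
    Matrix.mul_smul]

/-- `detOneSub` can be computed in any basis. -/
theorem detOneSub_eq_det {R M ι : Type*} [CommRing R] [AddCommGroup M] [Module R M] [Fintype ι]
    [DecidableEq ι] (b : Module.Basis ι R M) (f : M →ₗ[R] M) :
    detOneSub f = (1 - (Polynomial.X : Polynomial R) •
      (LinearMap.toMatrix b b f).map Polynomial.C).det := by
  rw [detOneSub, ← LinearMap.det_toMatrix (Algebra.TensorProduct.basis (Polynomial R) b)]
  congr 1
  ext1 i j
  rcases eq_or_ne i j with rfl | h
  · simp [LinearMap.toMatrix_apply]
  · simp [LinearMap.toMatrix_apply, h]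

theorem coe_expand_detOneSub {R M ι : Type*} [CommRing R] [AddCommGroup M] [Module R M] [Fintype ι]
    [DecidableEq ι] (b : Module.Basis ι R M) (f : M →ₗ[R] M) (d : ℕ) :
    (Polynomial.expand R d (detOneSub f) : PowerSeries R) =
      revCharpoly d (LinearMap.toMatrix b b f) := by
  have h := RingHom.map_det ((Polynomial.coeToPowerSeries.ringHom (R := R)).comp
    (Polynomial.expand R d).toRingHom) (1 - (Polynomial.X : Polynomial R) •
      (LinearMap.toMatrix b b f).map Polynomial.C)
  rw [← detOneSub_eq_det] at h
  refine h.trans ?_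
  rw [revCharpoly]
  congr 1
  ext1 i j
  rcases eq_or_ne i j with rfl | h
  · simp [mul_comm (PowerSeries.C _)]
  · simp [h, mul_comm (PowerSeries.C _)]

theorem coe_detOneSub {R M ι : Type*} [CommRing R] [AddCommGroup M] [Module R M] [Fintype ι]
    [DecidableEq ι] (b : Module.Basis ι R M) (f : M →ₗ[R] M) :
    (detOneSub f : PowerSeries R) = revCharpoly 1 (LinearMap.toMatrix b b f) := by
  rw [← coe_expand_detOneSub b f 1, Polynomial.expand_one]

section LogDeriv

variable {R : Type*} [CommRing R]

/-- The logarithmic derivative `F ↦ T F' / F`, as a homomorphism from the unit group of `R⟦T⟧`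
(written additively) to `R⟦T⟧`. -/
def logDeriv : Additive (PowerSeries R)ˣ →+ PowerSeries R where
  toFun F := PowerSeries.X * PowerSeries.derivative R (F.toMul : PowerSeries R) *
    (↑(F.toMul⁻¹) : PowerSeries R)
  map_zero' := by simp
  map_add' F G := by
    have h1 : (F.toMul : PowerSeries R) * (↑(F.toMul⁻¹) : PowerSeries R) = 1 := Units.mul_inv _
    have h2 : (G.toMul : PowerSeries R) * (↑(G.toMul⁻¹) : PowerSeries R) = 1 := Units.mul_inv _
    simp only [toMul_add, Units.val_mul, Derivation.leibniz, smul_eq_mul, mul_inv]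
    linear_combination
      (PowerSeries.X * PowerSeries.derivative R (G.toMul : PowerSeries R) *
        (↑(G.toMul⁻¹) : PowerSeries R)) * h1 +
      (PowerSeries.X * PowerSeries.derivative R (F.toMul : PowerSeries R) *
        (↑(F.toMul⁻¹) : PowerSeries R)) * h2

theorem logDeriv_eq {F : (PowerSeries R)ˣ} {g : PowerSeries R}
    (h : PowerSeries.X * PowerSeries.derivative R (F : PowerSeries R) = (F : PowerSeries R) * g) :
    logDeriv (Additive.ofMul F) = g := by
  change PowerSeries.X * PowerSeries.derivative R (F : PowerSeries R) *
    (↑F⁻¹ : PowerSeries R) = g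
  rw [h, mul_right_comm, Units.mul_inv, one_mul]

theorem X_mul_derivative_eq_mul_logDeriv (F : (PowerSeries R)ˣ) :
    PowerSeries.X * PowerSeries.derivative R (F : PowerSeries R) =
      (F : PowerSeries R) * logDeriv (Additive.ofMul F) := by
  change _ = (F : PowerSeries R) * (PowerSeries.X * PowerSeries.derivative R (F : PowerSeries R) *
    (↑F⁻¹ : PowerSeries R))
  rw [mul_comm (F : PowerSeries R), mul_assoc, Units.inv_mul, mul_one]

theorem coeff_X_mul_derivative (f : PowerSeries R) (n : ℕ) :
    PowerSeries.coeff n (PowerSeries.X * PowerSeries.derivative R f) =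
      n * PowerSeries.coeff n f := by
  cases n with
  | zero => simp
  | succ n => rw [PowerSeries.coeff_succ_X_mul, PowerSeries.coeff_derivative]; push_cast; ring

theorem coeff_zero_logDeriv (F : Additive (PowerSeries R)ˣ) :
    PowerSeries.coeff 0 (logDeriv F) = 0 := by
  change PowerSeries.coeff 0 (PowerSeries.X * PowerSeries.derivative R (F.toMul : PowerSeries R) *
    (↑(F.toMul⁻¹) : PowerSeries R)) = 0
  simp

/-- Over a torsion-free ring, the logarithmic derivative modulo `T ^ (N + 1)` determines a power
series with constant coefficient `1` modulo `T ^ (N + 1)`. -/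
theorem coeff_eq_of_coeff_logDeriv_eq [IsAddTorsionFree R] {F G : (PowerSeries R)ˣ} {N : ℕ}
    (hF : PowerSeries.constantCoeff (F : PowerSeries R) = 1)
    (hG : PowerSeries.constantCoeff (G : PowerSeries R) = 1)
    (h : ∀ n ≤ N, n ≠ 0 → PowerSeries.coeff n (logDeriv (Additive.ofMul F)) =
      PowerSeries.coeff n (logDeriv (Additive.ofMul G))) :
    ∀ n ≤ N, PowerSeries.coeff n (F : PowerSeries R) = PowerSeries.coeff n (G : PowerSeries R) := by
  intro n
  induction n using Nat.strong_induction_on with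
  | _ n ih =>
    intro hn
    rcases Nat.eq_zero_or_pos n with rfl | hpos
    · rw [PowerSeries.coeff_zero_eq_constantCoeff, hF, hG]
    · refine nsmul_right_injective hpos.ne' ?_
      simp only [nsmul_eq_mul]
      rw [← coeff_X_mul_derivative, ← coeff_X_mul_derivative, X_mul_derivative_eq_mul_logDeriv,
        X_mul_derivative_eq_mul_logDeriv, PowerSeries.coeff_mul, PowerSeries.coeff_mul]
      refine Finset.sum_congr rfl fun ij hij => ?_
      have hij := Finset.HasAntidiagonal.mem_antidiagonal.1 hij
      rcases Nat.eq_zero_or_pos ij.2 with h0 | h0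
      · rw [h0, coeff_zero_logDeriv, coeff_zero_logDeriv, mul_zero, mul_zero]
      · rw [ih ij.1 (by omega) (by omega), h ij.2 (by omega) h0.ne']

theorem coeff_logDeriv_rescale (c : R) {F G : (PowerSeries R)ˣ}
    (h : (G : PowerSeries R) = PowerSeries.rescale c (F : PowerSeries R)) (n : ℕ) :
    PowerSeries.coeff n (logDeriv (Additive.ofMul G)) =
      c ^ n * PowerSeries.coeff n (logDeriv (Additive.ofMul F)) := by
  rw [← PowerSeries.coeff_rescale]
  congr 1
  refine logDeriv_eq ?_
  rw [h, ← map_mul, ← X_mul_derivative_eq_mul_logDeriv]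
  ext k
  rw [coeff_X_mul_derivative, PowerSeries.coeff_rescale, PowerSeries.coeff_rescale,
    coeff_X_mul_derivative]
  ring

theorem coeff_logDeriv_revCharpoly {n : Type*} [Fintype n] [DecidableEq n] {d : ℕ} (hd : 0 < d)
    {M : Matrix n n R} {F : (PowerSeries R)ˣ} (h : (F : PowerSeries R) = revCharpoly d M) {k : ℕ}
    (hk : k ≠ 0) :
    PowerSeries.coeff k (logDeriv (Additive.ofMul F)) =
      -if d ∣ k then (d : R) * (M ^ (k / d)).trace else 0 := by
  have h' := X_mul_derivative_revCharpoly hd M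
  rw [← h, ← mul_neg] at h'
  rw [logDeriv_eq h', map_neg, PowerSeries.coeff_mk]
  simp [hk]

theorem map_logDeriv {S : Type*} [CommRing S] (φ : R →+* S) (F : (PowerSeries R)ˣ) :
    PowerSeries.map φ (logDeriv (Additive.ofMul F)) =
      logDeriv (Additive.ofMul (Units.map (PowerSeries.map φ).toMonoidHom F)) := by
  refine (logDeriv_eq ?_).symm
  change _ = PowerSeries.map φ F * _
  rw [← map_mul, ← X_mul_derivative_eq_mul_logDeriv]
  ext k
  rw [coeff_X_mul_derivative, PowerSeries.coeff_map, coeff_X_mul_derivative]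
  simp

end LogDeriv

/-! ### Dwork's trace formula on the torus -/

section TraceFormula

variable {Λ : Type*} [CommRing Λ] {d m : ℕ}

/-- The matrix product `R(z) R(z^p) ⋯ R(z^(p^(n-1)))`. -/
def frobProd (p : ℕ) (R : Matrix (Fin m) (Fin m) (MvPolynomial (Fin d) Λ)) :
    ℕ → Matrix (Fin m) (Fin m) (MvPolynomial (Fin d) Λ)
  | 0 => 1
  | n + 1 => R * (frobProd p R n).map (MvPolynomial.expand p)

/-- The exponents `k ∈ ℕ^d` with `k_j ≥ 1` for all `j` and `∑ k_j < u`. The monomials `z^(-k)` form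
a basis of `H^d(ℙ^d, 𝒪(-u))`. -/
def expIndex (d u : ℕ) : Finset (Fin d →₀ ℕ) :=
  (Finset.Icc 0 (Finsupp.equivFunOnFinite.symm fun _ => u)).filter
    fun k => (∀ j, 1 ≤ k j) ∧ k.degree < u

theorem mem_expIndex {u : ℕ} {k : Fin d →₀ ℕ} :
    k ∈ expIndex d u ↔ (∀ j, 1 ≤ k j) ∧ k.degree < u := by
  refine ⟨fun h => (Finset.mem_filter.1 h).2, fun h => Finset.mem_filter.2 ⟨?_, h⟩⟩
  refine Finset.mem_Icc.2 ⟨fun j => Nat.zero_le _, fun j => ?_⟩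
  exact (Finsupp.le_degree j k).trans h.2.le

/-- The matrix whose `(l, k)` block is `r_(p k - l)`, the matrix of the coefficients of
`z^(p k - l)` in the entries of `R`. It is the matrix of `R ∘ F^*` in the basis `z^(-k)`. The coefficient is
written as that of `z^(p k)` in `z^l R`, so that it is zero unless `l ≤ p k`. -/
def dworkMatrix (p u : ℕ) (R : Matrix (Fin m) (Fin m) (MvPolynomial (Fin d) Λ)) :
    Matrix (expIndex d u × Fin m) (expIndex d u × Fin m) Λ :=
  Matrix.of fun a b =>
    (MvPolynomial.monomial a.1.1 1 * R a.2 b.2).coeff (p • b.1.1)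

/-- The identity `ψ(g(z) f(z^p)) = ψ(g) f` for the Cartier operator
`ψ(∑ a_k z^k) = ∑ a_(p k) z^k`. -/
theorem coeff_mul_expand {p : ℕ} (hp : p ≠ 0) (g f : MvPolynomial (Fin d) Λ) (K : Fin d →₀ ℕ)
    (T : Finset (Fin d →₀ ℕ)) (hT : ∀ h, g.coeff (p • h) ≠ 0 → h ∈ T) :
    (g * MvPolynomial.expand p f).coeff (p • K) =
      ∑ h ∈ T, g.coeff (p • h) * (MvPolynomial.monomial h 1 * f).coeff K := by
  induction f using MvPolynomial.induction_on' with
  | add f₁ f₂ h₁ h₂ =>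
    simp only [map_add, mul_add, MvPolynomial.coeff_add, Finset.sum_add_distrib, h₁, h₂]
  | monomial b c =>
    simp only [MvPolynomial.expand_monomial, MvPolynomial.coeff_mul_monomial',
      MvPolynomial.monomial_mul, one_mul, MvPolynomial.coeff_monomial]
    by_cases hb : b ≤ K
    · obtain ⟨h, rfl⟩ := exists_add_of_le hb
      have h1 : p • b ≤ p • (b + h) := fun j => by simp
      rw [if_pos h1, smul_add, add_tsub_cancel_left]
      have h2 : ∀ x, (x + b = b + h) ↔ x = h := fun x => by rw [add_comm b, add_left_inj]
      simp only [h2, mul_ite, mul_zero, Finset.sum_ite_eq']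
      split_ifs with hh
      · rfl
      · rw [not_not.1 fun h' => hh (hT h h'), zero_mul]
    · have h1 : ¬ p • b ≤ p • K := fun h => hb fun j => by
        have := h j
        simpa [Nat.pos_of_ne_zero hp] using this
      rw [if_neg h1, Finset.sum_eq_zero]
      intro x _
      rw [if_neg, mul_zero]
      rintro rfl
      exact hb le_add_self

theorem one_le_of_coeff_ne_zero {f : MvPolynomial (Fin d) Λ}
    (hf : (∏ k, MvPolynomial.X k) ∣ f) {c : Fin d →₀ ℕ} (hc : f.coeff c ≠ 0) (j : Fin d) :
    1 ≤ c j := by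
  obtain ⟨g, rfl⟩ := (Finset.dvd_prod_of_mem _ (Finset.mem_univ j)).trans hf
  rw [MvPolynomial.coeff_X_mul'] at hc
  by_contra h
  exact hc (if_neg (by simpa using h))

variable {p u : ℕ} {R : Matrix (Fin m) (Fin m) (MvPolynomial (Fin d) Λ)}

theorem degree_le_totalDegree {f : MvPolynomial (Fin d) Λ} {c : Fin d →₀ ℕ} (hc : f.coeff c ≠ 0) :
    c.degree ≤ f.totalDegree :=
  MvPolynomial.le_totalDegree (MvPolynomial.mem_support_iff.2 hc)

/-- The operator `g ↦ ψ(f g)` preserves the span of the monomials with exponents in `expIndex d u`: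
if `e = p h - l` is an exponent of `f`, then `p h_j = l_j + e_j > 0` and
`p |h| = |l| + |e| < u + (p - 1) u`. -/
theorem mem_expIndex_of_coeff_ne_zero {f : MvPolynomial (Fin d) Λ}
    (hf : (∏ k, MvPolynomial.X k) ∣ f) (hu : f.totalDegree < (p - 1) * u) {l h : Fin d →₀ ℕ}
    (hl : l ∈ expIndex d u) (hc : (MvPolynomial.monomial l 1 * f).coeff (p • h) ≠ 0) :
    h ∈ expIndex d u := by
  rw [MvPolynomial.coeff_monomial_mul', one_mul] at hc
  split_ifs at hc with hle
  · obtain ⟨e, he⟩ := exists_add_of_le hle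
    rw [he, add_tsub_cancel_left] at hc
    rw [mem_expIndex] at hl ⊢
    refine ⟨fun j => ?_, ?_⟩
    · have h1 := one_le_of_coeff_ne_zero hf hc j
      have h2 := DFunLike.congr_fun he j
      simp only [Finsupp.smul_apply, Finsupp.add_apply, smul_eq_mul] at h2
      rcases Nat.eq_zero_or_pos (h j) with h0 | h0
      · rw [h0] at h2
        omega
      · exact h0
    · have h1 := (degree_le_totalDegree hc).trans_lt hu
      have h2 := congrArg Finsupp.degree he
      rw [map_nsmul, map_add, smul_eq_mul] at h2
      have h3 : p * h.degree < p * u := by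
        rcases Nat.eq_zero_or_pos p with rfl | hp
        · simp at h1
        · obtain ⟨q, rfl⟩ := Nat.exists_eq_add_of_le' hp
          rw [Nat.add_sub_cancel] at h1
          rw [h2, add_mul]
          omega
      exact Nat.lt_of_mul_lt_mul_left h3
  · exact absurd rfl hc

theorem dworkMatrix_pow_apply (hp : p ≠ 0) (hr : ∀ i j, (∏ k, MvPolynomial.X k) ∣ R i j)
    (hu : ∀ i j, (R i j).totalDegree < (p - 1) * u) (n : ℕ) (a b : expIndex d u × Fin m) :
    (dworkMatrix p u R ^ n) a b =
      (MvPolynomial.monomial a.1.1 1 * frobProd p R n a.2 b.2).coeff (p ^ n • b.1.1) := by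
  induction n generalizing a b with
  | zero =>
    rcases a with ⟨⟨l, hl⟩, i⟩
    rcases b with ⟨⟨k, hk⟩, j⟩
    rw [pow_zero, pow_zero, one_smul, frobProd, Matrix.one_apply, Matrix.one_apply]
    by_cases hij : i = j <;> by_cases hlk : l = k <;>
      simp [hij, hlk, MvPolynomial.coeff_monomial]
  | succ n ih =>
    rw [pow_succ', Matrix.mul_apply, frobProd, Matrix.mul_apply, Finset.mul_sum,
      MvPolynomial.coeff_sum, Fintype.sum_prod_type_right]
    refine Finset.sum_congr rfl fun c _ => ?_
    rw [← mul_assoc, pow_succ', mul_smul, Matrix.map_apply, coeff_mul_expand hp _ _ _ (expIndex d u)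
      fun h hh => mem_expIndex_of_coeff_ne_zero (hr _ _) (hu _ _) a.1.2 hh]
    refine Eq.trans ?_ (Finset.sum_coe_sort (expIndex d u) _)
    refine Finset.sum_congr rfl fun h _ => ?_
    rw [ih]
    rfl

theorem prod_X_dvd_frobProd (hr : ∀ i j, (∏ k, MvPolynomial.X k) ∣ R i j) {n : ℕ} (hn : n ≠ 0)
    (i j : Fin m) : (∏ k, MvPolynomial.X k) ∣ frobProd p R n i j := by
  obtain ⟨n, rfl⟩ := Nat.exists_eq_succ_of_ne_zero hn
  rw [frobProd, Matrix.mul_apply]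
  exact Finset.dvd_sum fun a _ => Dvd.dvd.mul_right (hr i a) _

theorem totalDegree_frobProd {D : ℕ} (hD : ∀ i j, (R i j).totalDegree ≤ D) (n : ℕ)
    (i j : Fin m) : (frobProd p R n i j).totalDegree ≤ D * ∑ s ∈ Finset.range n, p ^ s := by
  induction n generalizing i j with
  | zero =>
    rw [frobProd, Matrix.one_apply]
    split_ifs <;> simp
  | succ n ih =>
    rw [frobProd, Matrix.mul_apply]
    refine MvPolynomial.totalDegree_finsetSum_le fun a _ => ?_
    refine (MvPolynomial.totalDegree_mul _ _).trans ?_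
    rw [Matrix.map_apply, MvPolynomial.totalDegree_expand, Finset.sum_range_succ', pow_zero]
    simp only [pow_succ, ← Finset.sum_mul]
    calc _ ≤ D + (D * ∑ s ∈ Finset.range n, p ^ s) * p :=
          Nat.add_le_add (hD i a) (Nat.mul_le_mul_right p (ih a j))
      _ = _ := by ring

/-- The exponents of `frobProd p R n` divisible by `p ^ n - 1` are accounted for by `expIndex d u`,
since the degree of `frobProd p R n` is less than `(p ^ n - 1) u`. -/
theorem mem_expIndex_of_coeff_frobProd_ne_zero (hp : 1 < p)
    (hr : ∀ i j, (∏ k, MvPolynomial.X k) ∣ R i j) (hu : ∀ i j, (R i j).totalDegree < (p - 1) * u)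
    {n : ℕ} (hn : n ≠ 0) {i j : Fin m} {c : Fin d →₀ ℕ}
    (hc : (frobProd p R n i j).coeff ((p ^ n - 1) • c) ≠ 0) : c ∈ expIndex d u := by
  rw [mem_expIndex]
  refine ⟨fun k => ?_, ?_⟩
  · have h1 := one_le_of_coeff_ne_zero (prod_X_dvd_frobProd hr hn i j) hc k
    rw [Finsupp.smul_apply, smul_eq_mul] at h1
    exact Nat.pos_of_mul_pos_left h1
  · have hD : ∀ i j, (R i j).totalDegree ≤ (p - 1) * u - 1 := fun i j =>
      Nat.le_sub_one_of_lt (hu i j)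
    have h1 := (degree_le_totalDegree hc).trans (totalDegree_frobProd hD n i j)
    have h2 : (p - 1) * ∑ s ∈ Finset.range n, p ^ s = p ^ n - 1 := by
      rw [mul_comm, Nat.geomSum_eq hp, Nat.div_mul_cancel (Nat.sub_one_dvd_pow_sub_one p n)]
    have h3 : 0 < ∑ s ∈ Finset.range n, p ^ s := by
      refine Finset.sum_pos (fun s _ => by positivity) ⟨0, by simpa using Nat.pos_of_ne_zero hn⟩
    rw [map_nsmul, smul_eq_mul, ← h2, mul_right_comm] at h1
    have h4 := Nat.le_of_mul_le_mul_right h1 h3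
    have h5 := hu i j
    exact Nat.lt_of_mul_lt_mul_left (a := p - 1) (by omega)

theorem trace_dworkMatrix_pow (hp : 1 < p) (hr : ∀ i j, (∏ k, MvPolynomial.X k) ∣ R i j)
    (hu : ∀ i j, (R i j).totalDegree < (p - 1) * u) (n : ℕ) :
    (dworkMatrix p u R ^ n).trace =
      ∑ i, ∑ k ∈ expIndex d u, (frobProd p R n i i).coeff ((p ^ n - 1) • k) := by
  rw [Matrix.trace, Fintype.sum_prod_type_right]
  refine Finset.sum_congr rfl fun i _ => ?_
  rw [← Finset.sum_coe_sort (expIndex d u) fun k => (frobProd p R n i i).coeff ((p ^ n - 1) • k)]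
  refine Finset.sum_congr rfl fun k _ => ?_
  have h1 : p ^ n • k.1 = k.1 + (p ^ n - 1) • k.1 := by
    conv_lhs => rw [← Nat.sub_add_cancel (Nat.one_le_pow n p (by omega)), add_smul, one_smul]
    exact add_comm _ _
  rw [Matrix.diag_apply, dworkMatrix_pow_apply (by omega) hr hu, h1,
    MvPolynomial.coeff_monomial_mul, one_mul]

/-- Orthogonality of characters: the sum of the values of a polynomial `f` at the points of `G^d`
is `|G|^d` times the sum of the coefficients of `f` at the exponents divisible by `|G|`. -/
theorem sum_aeval_eq {B G : Type*} [CommRing B] [Algebra Λ B] [CommGroup G] [Fintype G] (τ : G →* B)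
    (hτ : ∀ e : ℕ, ∑ g, τ g ^ e = if Fintype.card G ∣ e then (Fintype.card G : B) else 0)
    (f : MvPolynomial (Fin d) Λ) (T : Finset (Fin d →₀ ℕ))
    (hT : ∀ c, f.coeff (Fintype.card G • c) ≠ 0 → c ∈ T) :
    ∑ v : Fin d → G, MvPolynomial.aeval (fun j => τ (v j)) f =
      algebraMap Λ B ((Fintype.card G : Λ) ^ d *
        ∑ c ∈ T, f.coeff (Fintype.card G • c)) := by
  classical
  set N := Fintype.card G with hN
  have hN0 : N ≠ 0 := Fintype.card_ne_zero
  have h1 : ∀ c : Fin d →₀ ℕ, ∑ v : Fin d → G, ∏ j, τ (v j) ^ c j =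
      if ∀ j, N ∣ c j then (N : B) ^ d else 0 := fun c => by
    rw [← Fintype.piFinset_univ, ← Finset.prod_univ_sum (fun _ => Finset.univ)
      (fun j g => τ g ^ c j)]
    simp only [hτ]
    split_ifs with h
    · simp [h]
    · push Not at h
      obtain ⟨j, hj⟩ := h
      exact Finset.prod_eq_zero (Finset.mem_univ j) (if_neg hj)
  have h2 : ∀ v : Fin d → G, MvPolynomial.aeval (fun j => τ (v j)) f =
      ∑ c ∈ f.support, algebraMap Λ B (f.coeff c) * ∏ j, τ (v j) ^ c j := fun v => by
    rw [MvPolynomial.aeval_def, MvPolynomial.eval₂_eq']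
  simp only [h2]
  rw [Finset.sum_comm]
  simp only [← Finset.mul_sum, h1, mul_ite, mul_zero]
  rw [← Finset.sum_filter, map_mul, map_sum, map_pow, map_natCast, Finset.mul_sum]
  symm
  refine Finset.sum_bij_ne_zero (fun c _ _ => N • c) (fun c _ hne => ?_) (fun a _ _ b _ _ h => ?_)
    (fun c hc hne => ?_) fun c _ _ => mul_comm _ _
  · refine Finset.mem_filter.2 ⟨MvPolynomial.mem_support_iff.2 fun h0 => hne ?_, fun j => by simp⟩
    rw [h0, map_zero, mul_zero]
  · exact Finsupp.ext fun j => Nat.eq_of_mul_eq_mul_left (Nat.pos_of_ne_zero hN0)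
      (DFunLike.congr_fun h j)
  · obtain ⟨hs, hdvd⟩ := Finset.mem_filter.1 hc
    choose e he using hdvd
    have hce : c = N • Finsupp.equivFunOnFinite.symm e := Finsupp.ext he
    subst hce
    exact ⟨_, hT _ (MvPolynomial.mem_support_iff.1 hs), by rwa [mul_comm], rfl⟩

/-- The trace formula: the sum of the traces of `R(v) R(v^p) ⋯ R(v^(p^(n-1)))` over the points `v`
of `G^d`, where `G` is a group of order `p ^ n - 1` of roots of unity. -/
theorem sum_trace_frobProd {B G : Type*} [CommRing B] [Algebra Λ B] [CommGroup G] [Fintype G]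
    (τ : G →* B)
    (hτ : ∀ e : ℕ, ∑ g, τ g ^ e = if Fintype.card G ∣ e then (Fintype.card G : B) else 0)
    (hp : 1 < p) (hr : ∀ i j, (∏ k, MvPolynomial.X k) ∣ R i j)
    (hu : ∀ i j, (R i j).totalDegree < (p - 1) * u) {n : ℕ} (hn : n ≠ 0)
    (hG : Fintype.card G = p ^ n - 1) :
    ∑ v : Fin d → G, ((frobProd p R n).map (MvPolynomial.aeval fun j => τ (v j))).trace =
      algebraMap Λ B (((p : Λ) ^ n - 1) ^ d * (dworkMatrix p u R ^ n).trace) := by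
  have hcast : ((Fintype.card G : ℕ) : Λ) = (p : Λ) ^ n - 1 := by
    rw [hG, Nat.cast_sub (Nat.one_le_pow n p (by omega))]
    simp
  simp only [Matrix.trace, Matrix.diag_apply, Matrix.map_apply]
  rw [Finset.sum_comm]
  have h := fun i => sum_aeval_eq τ hτ (frobProd p R n i i) (expIndex d u) fun c hc =>
    mem_expIndex_of_coeff_frobProd_ne_zero hp hr hu hn (hG ▸ hc)
  simp only [h]
  rw [← map_sum, ← Finset.mul_sum, hcast, hG, ← trace_dworkMatrix_pow hp hr hu]
  rfl

end TraceFormula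

/-! ### The top cohomology and its basis -/

section TopCohomology

variable {p d m : ℕ} {Λ : Type*} [CommRing Λ] {u : ℤ}

/-- The exponent `-k ∈ ℤ^d` of the monomial `z^(-k)`. -/
def negExp (k : Fin d →₀ ℕ) : Fin d → ℤ := fun j => -(k j : ℤ)

theorem negExp_injective : Function.Injective (negExp (d := d)) := fun a b h =>
  Finsupp.ext fun j => by
    have := congrFun h j
    simp only [negExp] at this
    omega

theorem sum_negExp (k : Fin d →₀ ℕ) : -∑ j, negExp k j = (k.degree : ℤ) := by
  rw [Finsupp.degree_eq_sum]
  simp [negExp]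

theorem exists_negExp {n : Fin d → ℤ} (h1 : ∀ j, n j < 0) (h2 : -∑ j, n j < u) :
    ∃ k ∈ expIndex d u.toNat, negExp k = n := by
  have hk : negExp (Finsupp.equivFunOnFinite.symm fun j => (n j).natAbs) = n := by
    funext j
    have := h1 j
    simp only [negExp, Finsupp.equivFunOnFinite_symm_apply_apply]
    omega
  refine ⟨_, mem_expIndex.2 ⟨fun j => ?_, ?_⟩, hk⟩
  · have := h1 j
    simp only [Finsupp.equivFunOnFinite_symm_apply_apply]
    omega
  · rw [← hk, sum_negExp] at h2
    omega

/-- The index of the only set in the top degree of the Čech complex. -/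
def topIndex (d : ℕ) : {S : Finset (Fin (d + 1)) // S.card = d + 1} := ⟨Finset.univ, by simp⟩

theorem eq_topIndex (S : {S : Finset (Fin (d + 1)) // S.card = d + 1}) : S = topIndex d :=
  Subtype.ext (Finset.eq_univ_of_card _ (by rw [S.2, Fintype.card_fin]))

theorem differential_topIndex {e : ℕ} (b : Family (e + 1) m Λ e) (l : Fin m)
    (n : Fin (e + 1) → ℤ) :
    differential (e + 1) m Λ e b (topIndex (e + 1)) l n = ∑ i : Fin (e + 2),
      (-1) ^ (Finset.univ.filter (· < i)).card * b ⟨Finset.univ.erase i, by simp⟩ l n := by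
  rw [← Finset.sum_coe_sort Finset.univ]
  simp only [differential, LinearMap.coe_mk, AddHom.coe_mk, Finset.sum_apply, Pi.smul_apply,
    smul_eq_mul]
  rfl

/-- The coefficients of the monomials `z^(-k)`, `k ∈ expIndex d u`, of a top cocycle. -/
def topCoeff (p d m : ℕ) (Λ : Type*) [CommRing Λ] (u : ℤ) :
    cocycles p d m Λ u d →ₗ[Λ] (expIndex d u.toNat × Fin m → Λ) where
  toFun c a := c.1 (topIndex d) a.2 (negExp a.1.1)
  map_add' _ _ := rfl
  map_smul' _ _ := rfl

theorem mem_cocycles_top {c : Family d m Λ d}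
    (hc : ∀ l N, {n | c (topIndex d) l n ∉ Ideal.span {(p : Λ) ^ N}}.Finite) :
    c ∈ cocycles p d m Λ u d := by
  refine ⟨fun S l => ?_, ?_⟩
  · rw [eq_topIndex S]
    exact ⟨hc l, fun n _ => ⟨fun j hj => absurd (Finset.mem_univ _) hj,
      fun h => absurd (Finset.mem_univ _) h⟩⟩
  · refine LinearMap.mem_ker.2 (funext fun S => ?_)
    have := Finset.card_le_univ S.1
    rw [S.2, Fintype.card_fin] at this
    omega

theorem topCoeff_surjective : Function.Surjective (topCoeff p d m Λ u) := by
  classical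
  intro w
  refine ⟨⟨fun _ l n => ∑ k : expIndex d u.toNat, if n = negExp k.1 then w (k, l) else 0,
    mem_cocycles_top fun l N => ?_⟩, ?_⟩
  · refine (((expIndex d u.toNat).image negExp).finite_toSet).subset fun n hn => ?_
    by_contra h
    refine hn ?_
    rw [Finset.sum_eq_zero]
    · exact zero_mem _
    · intro k _
      rw [if_neg]
      rintro rfl
      exact h (Finset.mem_coe.2 (Finset.mem_image_of_mem _ k.2))
  · funext a
    change ∑ k : expIndex d u.toNat, (if negExp a.1.1 = negExp k.1 then w (k, a.2) else 0) = w a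
    rw [Finset.sum_eq_single a.1]
    · rw [if_pos rfl]
    · intro k _ hk
      exact if_neg fun h => hk (Subtype.ext (negExp_injective h)).symm
    · simp

/-- A top cocycle is a coboundary if and only if the coefficients of the monomials `z^(-k)`,
`k ∈ expIndex d u`, vanish: these are the only Laurent monomials that do not extend to a section over an
intersection of `d` of the `d + 1` affine opens. -/
theorem ker_topCoeff (hd : 0 < d) : LinearMap.ker (topCoeff p d m Λ u) =
    (coboundaries p d m Λ u d).submoduleOf (cocycles p d m Λ u d) := by
  classical
  obtain ⟨e, rfl⟩ := Nat.exists_eq_succ_of_ne_zero hd.ne'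
  ext ⟨c, hc⟩
  rw [LinearMap.mem_ker, Submodule.submoduleOf, Submodule.mem_comap]
  constructor
  · intro h
    have h0 : ∀ l, ∀ k ∈ expIndex (e + 1) u.toNat, c (topIndex (e + 1)) l (negExp k) = 0 :=
      fun l k hk => congrFun h (⟨k, hk⟩, l)
    -- a monomial `z^n` extends over the locus `Z_i ≠ 0` for some `i`, unless `n = -k`
    have hi : ∀ n : Fin (e + 1) → ℤ, ∃ i : Fin (e + 2), (∀ j : Fin (e + 1), i = j.succ → 0 ≤ n j) ∧
        (i = 0 → ∀ l, c (topIndex (e + 1)) l n ≠ 0 → u ≤ -∑ j, n j) := fun n => by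
      by_cases hn : ∃ j, 0 ≤ n j
      · obtain ⟨j, hj⟩ := hn
        refine ⟨j.succ, fun j' h' => ?_, fun h' => absurd h' (Fin.succ_ne_zero j)⟩
        rwa [← Fin.succ_injective _ h']
      · push Not at hn
        refine ⟨0, fun j h' => absurd h'.symm (Fin.succ_ne_zero j), fun _ l hl => ?_⟩
        by_contra hu
        obtain ⟨k, hk, rfl⟩ := exists_negExp hn (not_le.1 hu)
        exact hl (h0 l k hk)
    choose i hi1 hi2 using hi
    -- the monomial `z^n` is put on the intersection of the opens `Z_j ≠ 0`, `j ≠ i n`; the sign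
    -- makes the Čech differential return it with coefficient `1`
    refine ⟨fun S l n => if i n ∉ S.1 then
      (-1) ^ (Finset.univ.filter (· < i n)).card * c (topIndex (e + 1)) l n else 0, ?_, ?_⟩
    · intro S l
      have hS : ∀ a b, a ∉ S.1 → b ∉ S.1 → a = b := fun a b ha hb => by
        have h1 : (S.1)ᶜ.card ≤ 1 := by
          rw [Finset.card_compl, S.2, Fintype.card_fin]
          omega
        exact Finset.card_le_one.1 h1 a (Finset.mem_compl.2 ha) b (Finset.mem_compl.2 hb)
      refine ⟨fun N => ((hc.1 (topIndex (e + 1)) l).1 N).subset fun n hn hmem => hn ?_,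
        fun n hn => ?_⟩
      · dsimp only
        split_ifs
        · exact zero_mem _
        · exact Ideal.mul_mem_left _ _ hmem
      · dsimp only at hn
        split_ifs at hn with hin
        · exact absurd rfl hn
        · exact ⟨fun j hj => hi1 n j (hS _ _ hin hj),
            fun h0 => hi2 n (hS _ _ hin h0) l (right_ne_zero_of_mul hn)⟩
    · funext S l n
      rw [eq_topIndex S]
      rw [differential_topIndex, Finset.sum_eq_single (i n)]
      · rw [if_pos (Finset.notMem_erase _ _), ← mul_assoc, ← mul_pow, neg_one_mul, neg_neg, one_pow,
          one_mul]
        rfl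
      · intro i' _ hne
        rw [if_neg (not_not.2 (Finset.mem_erase.2 ⟨hne.symm, Finset.mem_univ _⟩)), mul_zero]
      · exact fun h => absurd (Finset.mem_univ _) h
  · rintro ⟨b, hb, hbc⟩
    funext ⟨⟨k, hk⟩, l⟩
    obtain ⟨hk1, hk2⟩ := mem_expIndex.1 hk
    change c (topIndex (e + 1)) l (negExp k) = 0
    have hbc' : differential (e + 1) m Λ e b = c := hbc
    rw [← hbc', differential_topIndex]
    refine Finset.sum_eq_zero fun i _ => mul_eq_zero_of_right _ ?_
    by_contra hne
    obtain ⟨h1, h2⟩ := (hb _ l).2 _ hne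
    rcases Fin.eq_zero_or_eq_succ i with h0 | ⟨j, hj⟩
    · have := h2 (by simp [h0])
      rw [sum_negExp] at this
      omega
    · have := h1 j (by simp [hj])
      have := hk1 j
      have h3 : (0 : ℤ) ≤ -(k j : ℤ) := h1 j (by simp [hj])
      have := hk1 j
      omega

/-- `H^d(ℙ^d, Λ ⊗ 𝒪(-u)^m)` is free on the monomials `z^(-k)`, `k ∈ expIndex d u`. -/
def cohomologyEquiv (hd : 0 < d) :
    cohomology p d m Λ u d ≃ₗ[Λ] (expIndex d u.toNat × Fin m → Λ) :=
  (Submodule.quotEquivOfEq _ _ (ker_topCoeff hd).symm).trans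
    ((topCoeff p d m Λ u).quotKerEquivOfSurjective topCoeff_surjective)

/-- The coefficient of `z^(-l)` in `f F^*(a)`; only the coefficients of `a` at the basis monomials
contribute. -/
theorem polyMul_frobPullback_negExp (hp : p ≠ 0) {v : ℕ} {f : MvPolynomial (Fin d) Λ}
    (hf : (∏ k, MvPolynomial.X k) ∣ f) (hu : f.totalDegree < (p - 1) * v)
    (a : (Fin d → ℤ) → Λ) {l : Fin d →₀ ℕ} (hl : l ∈ expIndex d v) :
    polyMul f (frobPullback p a) (negExp l) =
      ∑ k ∈ expIndex d v, (MvPolynomial.monomial l 1 * f).coeff (p • k) * a (negExp k) := by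
  have key : ∀ k : Fin d →₀ ℕ, (MvPolynomial.monomial l 1 * f).coeff (p • k) ≠ 0 →
      l ≤ p • k ∧ (MvPolynomial.monomial l 1 * f).coeff (p • k) = f.coeff (p • k - l) := by
    intro k hk
    rw [MvPolynomial.coeff_monomial_mul'] at hk ⊢
    split_ifs at hk ⊢ with h
    · exact ⟨h, one_mul _⟩
    · exact absurd rfl hk
  have hdiv : ∀ k : Fin d →₀ ℕ, l ≤ p • k → ∀ j,
      negExp l j - ((p • k - l : Fin d →₀ ℕ) j : ℤ) = p * negExp k j := fun k hk j => by
    have h1 := hk j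
    simp only [Finsupp.smul_apply, smul_eq_mul] at h1
    simp only [negExp, Finsupp.coe_tsub, Pi.sub_apply, Finsupp.smul_apply, smul_eq_mul]
    push_cast [h1]
    ring
  have hp' : (p : ℤ) ≠ 0 := by exact_mod_cast hp
  have hval : ∀ k : Fin d →₀ ℕ, l ≤ p • k →
      frobPullback p a (fun j => negExp l j - ((p • k - l : Fin d →₀ ℕ) j : ℤ)) = a (negExp k) :=
    fun k hk => by
      simp only [frobPullback, hdiv k hk, dvd_mul_right, implies_true, if_true,
        Int.mul_ediv_cancel_left _ hp']
  symm
  refine Finset.sum_bij_ne_zero (fun k _ _ => p • k - l) (fun k _ hne => ?_)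
    (fun k₁ _ h₁ k₂ _ h₂ h => ?_) (fun α hα hne => ?_) fun k _ hne => ?_
  · obtain ⟨-, h2⟩ := key k (left_ne_zero_of_mul hne)
    rw [MvPolynomial.mem_support_iff, ← h2]
    exact left_ne_zero_of_mul hne
  · obtain ⟨h₁', -⟩ := key k₁ (left_ne_zero_of_mul h₁)
    obtain ⟨h₂', -⟩ := key k₂ (left_ne_zero_of_mul h₂)
    have h3 : p • k₁ = p • k₂ := by
      rw [← tsub_add_cancel_of_le h₁', ← tsub_add_cancel_of_le h₂', h]
    exact Finsupp.ext fun j => Nat.eq_of_mul_eq_mul_left (Nat.pos_of_ne_zero hp)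
      (DFunLike.congr_fun h3 j)
  · have hne' := right_ne_zero_of_mul hne
    unfold frobPullback at hne'
    split_ifs at hne' with hd
    · obtain ⟨k, hk⟩ : ∃ k : Fin d →₀ ℕ, p • k = l + α := by
        have h1 : ∀ j, p ∣ l j + α j := fun j => by
          have := hd j
          simp only [negExp] at this
          have h2 : (p : ℤ) ∣ -(-(l j : ℤ) - α j) := (dvd_neg).2 this
          rw [show -(-(l j : ℤ) - α j) = ((l j + α j : ℕ) : ℤ) by push_cast; ring] at h2
          exact_mod_cast h2
        choose k hk using h1
        exact ⟨Finsupp.equivFunOnFinite.symm k, Finsupp.ext fun j => (hk j).symm⟩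
      have h3 : l ≤ p • k := hk ▸ le_self_add
      have h4 : p • k - l = α := by rw [hk, add_tsub_cancel_left]
      have h5 : (MvPolynomial.monomial l 1 * f).coeff (p • k) = f.coeff α := by
        rw [MvPolynomial.coeff_monomial_mul', if_pos h3, one_mul, h4]
      have h6 : (MvPolynomial.monomial l 1 * f).coeff (p • k) ≠ 0 :=
        h5 ▸ left_ne_zero_of_mul hne
      refine ⟨k, mem_expIndex_of_coeff_ne_zero hf hu hl h6, ?_, h4⟩
      rw [h5, ← hval k h3, h4]
      exact hne
    · exact absurd rfl hne'
  · obtain ⟨h1, h2⟩ := key k (left_ne_zero_of_mul hne)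
    rw [h2, hval k h1]

/-- `H^d(r ∘ F^*)` is given by the Dwork matrix. -/
theorem toMatrix_cohomologyMap [Fact p.Prime] (hd : 0 < d)
    {r : Matrix (Fin m) (Fin m) (MvPolynomial (Fin d) Λ)}
    (hr : ∀ i j, (∏ k, MvPolynomial.X k) ∣ r i j)
    (hu : ∀ i j, ((r i j).totalDegree : ℤ) < (p - 1) * u)
    (hu' : ∀ i j, (r i j).totalDegree < (p - 1) * u.toNat) :
    LinearMap.toMatrix
      (Module.Basis.ofEquivFun (cohomologyEquiv (p := p) (m := m) (Λ := Λ) (u := u) hd))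
      (Module.Basis.ofEquivFun (cohomologyEquiv (p := p) (m := m) (Λ := Λ) (u := u) hd))
      (cohomologyMap r hu d) =
        dworkMatrix p u.toNat r := by
  have key : ∀ x, cohomologyEquiv (p := p) (m := m) (Λ := Λ) (u := u) hd (cohomologyMap r hu d x) =
      (dworkMatrix p u.toNat r).mulVec
        (cohomologyEquiv (p := p) (m := m) (Λ := Λ) (u := u) hd x) := by
    intro x
    obtain ⟨c, rfl⟩ := Submodule.Quotient.mk_surjective _ x
    funext ⟨⟨l, hl⟩, i⟩
    change (∑ j, polyMul (r i j) (frobPullback p (c.1 (topIndex d) j))) (negExp l) =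
      ∑ b : expIndex d u.toNat × Fin m, (MvPolynomial.monomial l 1 * r i b.2).coeff (p • b.1.1) *
        c.1 (topIndex d) b.2 (negExp b.1.1)
    rw [Finset.sum_apply, Fintype.sum_prod_type_right]
    refine Finset.sum_congr rfl fun j _ => ?_
    rw [polyMul_frobPullback_negExp (Fact.out (p := p.Prime)).ne_zero (hr i j) (hu' i j) _ hl]
    exact (Finset.sum_coe_sort (expIndex d u.toNat) _).symm
  ext a b
  rw [LinearMap.toMatrix_apply, Module.Basis.ofEquivFun_repr_apply, key,
    Module.Basis.coe_ofEquivFun, LinearEquiv.apply_symm_apply, Matrix.mulVec_single_one]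
  rfl

end TopCohomology

/-! ### Values at Teichmüller points and Frobenius invariants -/

section Teichmuller

variable {p : ℕ} [hp : Fact p.Prime] {d m : ℕ}
variable {k k' : Type*} [CommRing k] [Algebra (ZMod p) k] [CommRing k'] [Algebra (ZMod p) k']

/-- `W(φ)` as a homomorphism of `ℤ_p`-algebras. -/
def wittMap (φ : k →ₐ[ZMod p] k') : WittVector p k →ₐ[ℤ_[p]] WittVector p k' where
  __ := WittVector.map φ.toRingHom
  commutes' c := by
    change WittVector.map φ.toRingHom (WittVector.map _ ((WittVector.equiv p).symm c)) =
      WittVector.map _ ((WittVector.equiv p).symm c)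
    ext n
    simp [WittVector.map_coeff]

variable (Λ : Type*) [CommRing Λ] [Algebra ℤ_[p] Λ]

/-- `1 ⊗ W(φ)` on `Λ ⊗ W(k)`. -/
def wittTensorMap (φ : k →ₐ[ZMod p] k') :
    Λ ⊗[ℤ_[p]] WittVector p k →ₐ[Λ] Λ ⊗[ℤ_[p]] WittVector p k' :=
  Algebra.TensorProduct.map (AlgHom.id Λ Λ) (wittMap φ)

variable {Λ}

variable (p) in
/-- The evaluation of polynomials at the Teichmüller lift of a point `a` of affine space. -/
def teichEval (a : Fin d → k) : MvPolynomial (Fin d) Λ →ₐ[Λ] Λ ⊗[ℤ_[p]] WittVector p k :=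
  MvPolynomial.aeval fun i => (1 : Λ) ⊗ₜ[ℤ_[p]] WittVector.teichmuller p (a i)

theorem wittTensorMap_teichEval (φ : k →ₐ[ZMod p] k') (a : Fin d → k)
    (f : MvPolynomial (Fin d) Λ) :
    wittTensorMap Λ φ (teichEval p a f) = teichEval p (fun i => φ (a i)) f := by
  have h : (wittTensorMap Λ φ).comp (teichEval (Λ := Λ) p a) = teichEval p fun i => φ (a i) := by
    ext i
    simp only [AlgHom.comp_apply, teichEval, MvPolynomial.aeval_X, wittTensorMap,
      Algebra.TensorProduct.map_tmul, map_one]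
    congr 1
    exact WittVector.map_teichmuller p φ.toRingHom (a i)
  exact DFunLike.congr_fun h f

theorem teichEval_expand (a : Fin d → k) (f : MvPolynomial (Fin d) Λ) :
    teichEval p a (MvPolynomial.expand p f) = teichEval p (fun i => a i ^ p) f := by
  simp only [teichEval, MvPolynomial.aeval_expand]
  congr 2
  funext i
  simp [Algebra.TensorProduct.tmul_pow]

variable (r : Matrix (Fin m) (Fin m) (MvPolynomial (Fin d) Λ))

variable (p) in
/-- The value `r(ã) r(ã^p) ⋯ r(ã^(p^(n-1)))` at the Teichmüller lift `ã` of `a`. -/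
def teichProd (n : ℕ) (a : Fin d → k) : Matrix (Fin m) (Fin m) (Λ ⊗[ℤ_[p]] WittVector p k) :=
  (frobProd p r n).map (teichEval p a)

theorem teichProd_zero (a : Fin d → k) : teichProd p r 0 a = 1 :=
  Matrix.map_one _ (map_zero _) (map_one _)

theorem teichProd_succ (n : ℕ) (a : Fin d → k) :
    teichProd p r (n + 1) a = r.map (teichEval p a) * teichProd p r n fun i => a i ^ p := by
  rw [teichProd, frobProd, Matrix.map_mul, Matrix.map_map, teichProd]
  congr 1
  ext i j
  exact teichEval_expand a _

theorem teichProd_add (s t : ℕ) (a : Fin d → k) :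
    teichProd p r (s + t) a = teichProd p r s a * teichProd p r t fun i => a i ^ p ^ s := by
  induction s generalizing a with
  | zero => simp [teichProd_zero]
  | succ s ih =>
    rw [Nat.succ_add, teichProd_succ, teichProd_succ, ih, mul_assoc]
    simp only [← pow_mul, ← pow_succ']

theorem teichProd_mul {s : ℕ} {a : Fin d → k} (ha : ∀ i, a i ^ p ^ s = a i) (t : ℕ) :
    teichProd p r (s * t) a = teichProd p r s a ^ t := by
  induction t with
  | zero => simp [teichProd_zero]
  | succ t ih =>
    rw [Nat.mul_succ, Nat.add_comm, teichProd_add, pow_succ']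
    simp only [ha, ih]

theorem teichProd_map (φ : k →ₐ[ZMod p] k') (n : ℕ) (a : Fin d → k) :
    (teichProd p r n a).map (wittTensorMap Λ φ) = teichProd p r n fun i => φ (a i) := by
  ext i j
  exact wittTensorMap_teichEval φ a _

/-- If `a` is fixed by the `n`-th power of Frobenius, then Frobenius permutes the factors of
`teichProd p r n a` cyclically. -/
theorem exists_teichProd_eq_mul {n : ℕ} (hn : n ≠ 0) {a : Fin d → k} (ha : ∀ i, a i ^ p ^ n = a i) :
    ∃ A B, teichProd p r n a = A * B ∧ (teichProd p r n fun i => a i ^ p) = B * A := by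
  obtain ⟨n, rfl⟩ := Nat.exists_eq_succ_of_ne_zero hn
  refine ⟨_, _, teichProd_succ r n a, ?_⟩
  rw [Nat.succ_eq_add_one, teichProd_add, teichProd_succ, teichProd_zero, mul_one]
  simp only [← pow_mul, ← pow_succ', ha]

variable (p k) in
/-- The Frobenius endomorphism of `k`, as a homomorphism of `𝔽_p`-algebras. -/
def frobAlgHom : k →ₐ[ZMod p] k := FiniteField.frobeniusAlgHom (ZMod p) k

theorem frobAlgHom_apply (a : k) : frobAlgHom p k a = a ^ p := by
  simp [frobAlgHom]

theorem trace_teichProd_frob {n : ℕ} (hn : n ≠ 0) {a : Fin d → k} (ha : ∀ i, a i ^ p ^ n = a i) :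
    wittTensorMap Λ (frobAlgHom p k) (teichProd p r n a).trace = (teichProd p r n a).trace := by
  obtain ⟨A, B, h1, h2⟩ := exists_teichProd_eq_mul r hn ha
  have h3 := teichProd_map r (frobAlgHom p k) n a
  simp only [frobAlgHom_apply] at h3
  have h4 := AddMonoidHom.map_trace (wittTensorMap Λ (frobAlgHom p k)).toRingHom.toAddMonoidHom
    (teichProd p r n a)
  refine h4.trans ((congrArg Matrix.trace h3).trans ?_)
  rw [h1, h2, Matrix.trace_mul_comm]

theorem revCharpoly_teichProd_frob (e : ℕ) {n : ℕ} (hn : n ≠ 0) {a : Fin d → k}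
    (ha : ∀ i, a i ^ p ^ n = a i) :
    PowerSeries.map (wittTensorMap Λ (frobAlgHom p k)).toRingHom
      (revCharpoly e (teichProd p r n a)) = revCharpoly e (teichProd p r n a) := by
  obtain ⟨A, B, h1, h2⟩ := exists_teichProd_eq_mul r hn ha
  have h3 := teichProd_map r (frobAlgHom p k) n a
  simp only [frobAlgHom_apply] at h3
  rw [map_revCharpoly]
  refine (congrArg (revCharpoly e) h3).trans ?_
  rw [h1, h2, revCharpoly_mul_comm]

end Teichmuller

section Invariants

variable {p : ℕ} [hp : Fact p.Prime] {k : Type*} [Field k] [Algebra (ZMod p) k]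
variable {Λ : Type*} [CommRing Λ] [Algebra ℤ_[p] Λ]

theorem algebraMap_witt_injective : Function.Injective (algebraMap ℤ_[p] (WittVector p k)) :=
  (WittVector.map_injective _ (algebraMap (ZMod p) k).injective).comp
    (WittVector.equiv p).symm.injective

theorem includeLeft_witt_injective [Module.Flat ℤ_[p] Λ] : Function.Injective
    (Algebra.TensorProduct.includeLeftRingHom : Λ →+* Λ ⊗[ℤ_[p]] WittVector p k) :=
  Algebra.TensorProduct.includeLeft_injective (S := Λ) algebraMap_witt_injective

/-- The Frobenius invariants of `W(k)` are `ℤ_p`: the Witt components of an invariant vector are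
fixed by the Frobenius of `k`, hence lie in `𝔽_p`. -/
theorem wittMap_frob_eq_self_iff (w : WittVector p k) :
    wittMap (frobAlgHom p k) w = w ↔ ∃ c, algebraMap ℤ_[p] (WittVector p k) c = w := by
  constructor
  · intro h
    have hcoeff : ∀ n, ∃ c : ZMod p, algebraMap (ZMod p) k c = w.coeff n := fun n => by
      have : CharP k p := charP_of_injective_algebraMap (algebraMap (ZMod p) k).injective p
      have h1 : (w.coeff n) ^ p = w.coeff n := by
        rw [← frobAlgHom_apply]
        conv_rhs => rw [← h]
        rfl
      obtain ⟨c, hc⟩ := (mem_bot_iff_intCast p k).1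
        ((Subfield.mem_bot_iff_pow_eq_self k p).2 h1)
      exact ⟨c, by rw [map_intCast, hc]⟩
    choose c hc using hcoeff
    refine ⟨WittVector.equiv p (WittVector.mk p c), ?_⟩
    change WittVector.map (algebraMap (ZMod p) k) ((WittVector.equiv p).symm _) = w
    rw [RingEquiv.symm_apply_apply]
    ext n
    rw [WittVector.map_coeff, WittVector.coeff_mk, hc]
  · rintro ⟨c, rfl⟩
    exact AlgHom.commutes _ c

/-- The Frobenius invariants of `Λ ⊗ W(k)` are `Λ`: the exact sequence `ℤ_p → W(k) → W(k)`, whose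
second map is `σ - 1`, stays exact on tensoring with the flat module `Λ`. -/
theorem exists_of_wittTensorMap_frob_eq [Module.Flat ℤ_[p] Λ] {z : Λ ⊗[ℤ_[p]] WittVector p k}
    (hz : wittTensorMap Λ (frobAlgHom p k) z = z) :
    ∃ c : Λ, Algebra.TensorProduct.includeLeftRingHom c = z := by
  let g : WittVector p k →ₗ[ℤ_[p]] WittVector p k :=
    { toFun := fun w => wittMap (frobAlgHom p k) w - w
      map_add' := fun v w => by rw [map_add]; ring
      map_smul' := fun c w => by rw [map_smul, RingHom.id_apply, smul_sub] }
  have hex : Function.Exact (Algebra.linearMap ℤ_[p] (WittVector p k)) g := fun w =>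
    sub_eq_zero.trans (wittMap_frob_eq_self_iff w)
  have h1 : ∀ y, g.lTensor Λ y = wittTensorMap Λ (frobAlgHom p k) y - y := fun y => by
    induction y using TensorProduct.induction_on with
    | zero => simp
    | tmul a w =>
      rw [LinearMap.lTensor_tmul, wittTensorMap, Algebra.TensorProduct.map_tmul]
      exact TensorProduct.tmul_sub _ _ _
    | add x y hx hy =>
      rw [map_add, hx, hy, map_add]
      ring
  have h2 : g.lTensor Λ z = 0 := by rw [h1, hz, sub_self]
  obtain ⟨y, rfl⟩ := (Module.Flat.lTensor_exact Λ hex z).1 h2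
  refine ⟨TensorProduct.rid ℤ_[p] Λ y, ?_⟩
  induction y using TensorProduct.induction_on with
  | zero => simp
  | tmul a c =>
    simp [Algebra.TensorProduct.includeLeftRingHom, Algebra.algebraMap_eq_smul_one]
  | add a b ha hb =>
    have h3 : ∀ y, g.lTensor Λ (LinearMap.lTensor Λ (Algebra.linearMap ℤ_[p] (WittVector p k)) y) =
        0 :=
      fun y => (Module.Flat.lTensor_exact Λ hex _).2 ⟨y, rfl⟩
    have h4 : ∀ y, wittTensorMap Λ (frobAlgHom p k)
        (LinearMap.lTensor Λ (Algebra.linearMap ℤ_[p] (WittVector p k)) y) = _ :=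
      fun y => sub_eq_zero.1 ((h1 _).symm.trans (h3 y))
    rw [map_add, map_add, map_add, ha (h4 a) (h3 a), hb (h4 b) (h3 b)]

end Invariants

section LocalFactors

variable {p : ℕ} [hp : Fact p.Prime] {d m : ℕ} {Λ : Type*} [CommRing Λ] [Algebra ℤ_[p] Λ]
variable (r : Matrix (Fin m) (Fin m) (MvPolynomial (Fin d) Λ)) (x : ClosedPoint p d)

theorem deg_pos : 0 < deg x := Module.finrank_pos

theorem residue_pow_deg (a : residue x) : a ^ p ^ deg x = a := by
  have : Finite (residue x) := Module.finite_of_finite (ZMod p)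
  have := Fintype.ofFinite (residue x)
  have hcard : Fintype.card (residue x) = p ^ deg x := by
    rw [Module.card_eq_pow_finrank (K := ZMod p), ZMod.card, deg]
  rw [← hcard, FiniteField.pow_card]

theorem residue_pow_of_deg_dvd {n : ℕ} (hn : deg x ∣ n) (a : residue x) : a ^ p ^ n = a := by
  obtain ⟨t, rfl⟩ := hn
  induction t with
  | zero => simp
  | succ t ih => rw [Nat.mul_succ, pow_add, pow_mul, ih, residue_pow_deg]

theorem sigma_eq : sigma Λ x = (wittTensorMap Λ (frobAlgHom p (residue x))).toRingHom := by
  have h : wittFrob x = wittMap (frobAlgHom p (residue x)) := by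
    ext w n
    change (WittVector.frobenius w).coeff n = frobAlgHom p (residue x) (w.coeff n)
    rw [WittVector.coeff_frobenius_charP, frobAlgHom_apply]
  rw [sigma, h]
  rfl

theorem sigma_teichProd (n : ℕ) (a : Fin d → residue x) :
    (teichProd p r n a).map (sigma Λ x) = teichProd p r n fun i => a i ^ p := by
  have h := teichProd_map r (frobAlgHom p (residue x)) n a
  simp only [frobAlgHom_apply] at h
  rw [sigma_eq]
  exact h

/-- The iterates of `r(x̃) ∘ σ`, as `σ` raises the coordinates of a Teichmüller point to the power
`p`. -/
theorem fibreFrob_iterate (n : ℕ) (v : Fin m → WittTensor Λ x) :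
    (fibreFrob r x)^[n] v =
      (teichProd p r n (coord x)).mulVec fun j => (sigma Λ x)^[n] (v j) := by
  induction n with
  | zero => simp [teichProd_zero]
  | succ n ih =>
    rw [Function.iterate_succ_apply', ih, teichProd_succ, ← sigma_teichProd, ← Matrix.mulVec_mulVec]
    change (r.map (teichEval p (coord x))).mulVec _ = _
    congr 1
    funext i
    simp only [Function.iterate_succ_apply']
    exact RingHom.map_mulVec (sigma Λ x) _ _ i

theorem toMatrix_fibreFrobPow :
    LinearMap.toMatrix (Pi.basisFun _ _) (Pi.basisFun _ _) (fibreFrobPow r x) =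
      teichProd p r (deg x) (coord x) := by
  have h : fibreFrobPow r x = Matrix.mulVecLin (teichProd p r (deg x) (coord x)) := by
    refine LinearMap.ext fun v => ?_
    change (fibreFrob r x)^[deg x] v = _
    rw [fibreFrob_iterate]
    simp only [sigma_iterate_deg]
    rfl
  rw [h]
  exact LinearMap.toMatrix'_toLin' _

theorem coe_localDet :
    (localDet r x : PowerSeries (WittTensor Λ x)) =
      revCharpoly (deg x) (teichProd p r (deg x) (coord x)) := by
  rw [localDet, coe_expand_detOneSub (Pi.basisFun _ _), toMatrix_fibreFrobPow]

theorem coeff_logDeriv_localFactor {E : (PowerSeries Λ)ˣ}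
    (hE : PowerSeries.map (Algebra.TensorProduct.includeLeftRingHom : Λ →+* WittTensor Λ x)
      (E : PowerSeries Λ) = (localDet r x : PowerSeries _)) {n : ℕ} (hn : n ≠ 0) :
    (Algebra.TensorProduct.includeLeftRingHom : Λ →+* WittTensor Λ x)
      (PowerSeries.coeff n (logDeriv (Additive.ofMul E))) =
      -if deg x ∣ n then (deg x : WittTensor Λ x) * (teichProd p r n (coord x)).trace else 0 := by
  rw [← PowerSeries.coeff_map, map_logDeriv, coeff_logDeriv_revCharpoly (deg_pos x)
    (M := teichProd p r (deg x) (coord x)) (hE.trans (coe_localDet r x)) hn]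
  congr 1
  split_ifs with h
  · rw [← teichProd_mul r fun i => residue_pow_deg x _, Nat.mul_div_cancel' h]
  · rfl

variable [Module.Flat ℤ_[p] Λ]

/-- The local determinant descends to a unit of `Λ⟦T⟧`, because it is invariant under Frobenius. -/
theorem exists_localFactor : ∃ E : (PowerSeries Λ)ˣ,
    PowerSeries.map (Algebra.TensorProduct.includeLeftRingHom : Λ →+* WittTensor Λ x)
      (E : PowerSeries Λ) = (localDet r x : PowerSeries _) ∧
    PowerSeries.constantCoeff (E : PowerSeries Λ) = 1 := by
  have hinj := includeLeft_witt_injective (p := p) (k := residue x) (Λ := Λ)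
  have h := revCharpoly_teichProd_frob r (deg x) (deg_pos x).ne' (a := coord x)
    fun i => residue_pow_deg x _
  have hc : ∀ n, ∃ c : Λ, Algebra.TensorProduct.includeLeftRingHom c =
      PowerSeries.coeff n (localDet r x : PowerSeries (WittTensor Λ x)) := fun n => by
    refine exists_of_wittTensorMap_frob_eq ?_
    rw [coe_localDet]
    conv_rhs => rw [← h]
    rw [PowerSeries.coeff_map]
    rfl
  choose c hc using hc
  have hmap : PowerSeries.map (Algebra.TensorProduct.includeLeftRingHom : Λ →+* WittTensor Λ x)
      (PowerSeries.mk c) = (localDet r x : PowerSeries _) := by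
    ext n
    rw [PowerSeries.coeff_map, PowerSeries.coeff_mk, hc]
  have hone : PowerSeries.constantCoeff (PowerSeries.mk c) = 1 := by
    apply hinj
    rw [← PowerSeries.coeff_zero_eq_constantCoeff, ← PowerSeries.coeff_map, hmap, coe_localDet,
      PowerSeries.coeff_zero_eq_constantCoeff, constantCoeff_revCharpoly (deg_pos x), map_one]
  obtain ⟨E, hE⟩ : IsUnit (PowerSeries.mk c) :=
    PowerSeries.isUnit_iff_constantCoeff.2 (hone ▸ isUnit_one)
  exact ⟨E, hE ▸ hmap, hE ▸ hone⟩

theorem exists_trace_teichProd {n : ℕ} (hn : n ≠ 0) (hdvd : deg x ∣ n) :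
    ∃ c : Λ, Algebra.TensorProduct.includeLeftRingHom c = (teichProd p r n (coord x)).trace :=
  exists_of_wittTensorMap_frob_eq
    (trace_teichProd_frob r hn fun _ => residue_pow_of_deg_dvd x hdvd _)

end LocalFactors

/-! ### Points of the torus over a finite field -/

section TorusPoints

variable {p : ℕ} [hp : Fact p.Prime] {d m : ℕ}

/-- The coordinate function `z_i`, as a unit of the coordinate ring of the torus. -/
def coordUnit (p : ℕ) [Fact p.Prime] {d : ℕ} (i : Fin d) : (TorusRing p d)ˣ :=
  Units.map (AddMonoidAlgebra.of (ZMod p) (Fin d → ℤ))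
    (toUnits (Multiplicative.ofAdd (Pi.single i 1)))

theorem coe_coordUnit (i : Fin d) :
    (coordUnit p i : TorusRing p d) = AddMonoidAlgebra.single (Pi.single i 1) 1 := rfl

variable {K : Type*} [Field K] [Algebra (ZMod p) K]

/-- A point of the torus is determined by its coordinates. -/
theorem torusRing_algHom_ext {f g : TorusRing p d →ₐ[ZMod p] K}
    (h : ∀ i : Fin d, f (coordUnit p i) = g (coordUnit p i)) : f = g := by
  have key : ∀ φ : TorusRing p d →ₐ[ZMod p] K, ∀ e : Fin d → ℤ,
      φ (AddMonoidAlgebra.single e 1) =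
        ((∏ i, Units.map φ.toRingHom.toMonoidHom (coordUnit p i) ^ e i : Kˣ) : K) := by
    intro φ e
    let ψ : Multiplicative (Fin d → ℤ) →* Kˣ := (Units.map φ.toRingHom.toMonoidHom).comp
      ((Units.map (AddMonoidAlgebra.of (ZMod p) (Fin d → ℤ))).comp toUnits.toMonoidHom)
    have h1 : Multiplicative.ofAdd e =
        ∏ i, (Multiplicative.ofAdd (Pi.single i 1 : Fin d → ℤ)) ^ e i := by
      rw [← Finset.univ_sum_single e, ofAdd_sum]
      refine Finset.prod_congr rfl fun i _ => ?_
      rw [← ofAdd_zsmul, ← Pi.single_smul, Finset.univ_sum_single, smul_eq_mul, mul_one]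
    change ((ψ (Multiplicative.ofAdd e) : Kˣ) : K) = _
    rw [h1, map_prod]
    simp only [map_zpow]
    rfl
  have h2 : ∀ e : Fin d → ℤ, f (AddMonoidAlgebra.single e 1) = g (AddMonoidAlgebra.single e 1) := by
    intro e
    rw [key, key]
    congr 2
    funext i
    congr 1
    exact Units.ext (h i)
  exact AddMonoidAlgebra.algHom_ext h2 (Subsingleton.elim _ _)

/-- The homomorphism from the coordinate ring of the torus to `K` with prescribed values at the
coordinate functions. -/
def torusEval (v : Fin d → Kˣ) : TorusRing p d →ₐ[ZMod p] K :=
  AddMonoidAlgebra.lift (ZMod p) K (Fin d → ℤ)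
    { toFun := fun e => ((∏ i, v i ^ (e.toAdd i) : Kˣ) : K)
      map_one' := by simp
      map_mul' := fun a b => by
        rw [← Units.val_mul, ← Finset.prod_mul_distrib]
        simp [zpow_add] }

theorem torusEval_coordUnit (v : Fin d → Kˣ) (i : Fin d) :
    torusEval (p := p) v (coordUnit p i) = v i := by
  classical
  rw [coe_coordUnit, torusEval, AddMonoidAlgebra.lift_single, one_smul]
  change ((∏ j, v j ^ (Pi.single i 1 : Fin d → ℤ) j : Kˣ) : K) = v i
  rw [Finset.prod_eq_single i]
  · simp
  · intro j _ hj
    simp [hj]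
  · simp

/-- The point of the torus over `K` given by a closed point and an embedding of its residue field
into `K`. -/
def torusPoint (y : Σ x : ClosedPoint p d, residue x →ₐ[ZMod p] K) : Fin d → Kˣ := fun i =>
  Units.map (y.2.comp (Ideal.Quotient.mkₐ (ZMod p) y.1.asIdeal)).toRingHom.toMonoidHom
    (coordUnit p i)

theorem torusPoint_injective : Function.Injective (torusPoint (p := p) (d := d) (K := K)) := by
  rintro ⟨x, φ⟩ ⟨y, ψ⟩ h
  have h1 : φ.comp (Ideal.Quotient.mkₐ (ZMod p) x.asIdeal) =
      ψ.comp (Ideal.Quotient.mkₐ (ZMod p) y.asIdeal) :=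
    torusRing_algHom_ext fun i => congrArg Units.val (congrFun h i)
  have hker : ∀ (x : ClosedPoint p d) (φ : residue x →ₐ[ZMod p] K) (a : TorusRing p d),
      φ.comp (Ideal.Quotient.mkₐ (ZMod p) x.asIdeal) a = 0 ↔ a ∈ x.asIdeal := fun x φ a => by
    rw [AlgHom.comp_apply, map_eq_zero_iff φ φ.toRingHom.injective]
    exact Ideal.Quotient.eq_zero_iff_mem
  obtain rfl : x = y := MaximalSpectrum.ext (Ideal.ext fun a => by
    rw [← hker x φ, ← hker y ψ, h1])
  obtain rfl : φ = ψ := AlgHom.ext fun b => by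
    obtain ⟨a, rfl⟩ := Ideal.Quotient.mk_surjective b
    exact DFunLike.congr_fun h1 a
  rfl

theorem torusPoint_surjective [Finite K] :
    Function.Surjective (torusPoint (p := p) (d := d) (K := K)) := by
  intro v
  have hinj := (torusEval (p := p) v).toRingHom.kerLift_injective
  have hfin : Finite (TorusRing p d ⧸ RingHom.ker (torusEval (p := p) v).toRingHom) :=
    Finite.of_injective _ hinj
  have hprime := RingHom.ker_isPrime (torusEval (p := p) v).toRingHom
  have hmax : (RingHom.ker (torusEval (p := p) v).toRingHom).IsMaximal :=
    Ideal.Quotient.maximal_of_isField _ (Finite.isField_of_domain _)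
  refine ⟨⟨⟨_, hmax⟩, Ideal.Quotient.liftₐ _ (torusEval (p := p) v) fun a ha => ha⟩, ?_⟩
  funext i
  refine Units.ext ?_
  exact torusEval_coordUnit v i

theorem deg_dvd_of_algHom [Finite K] {x : ClosedPoint p d} (φ : residue x →ₐ[ZMod p] K) :
    deg x ∣ Module.finrank (ZMod p) K :=
  FiniteField.nonempty_algHom_iff_finrank_dvd.1 ⟨φ⟩

/-- There are only finitely many closed points of degree dividing `n`: each of them is the image of
a point with values in the field with `p ^ n` elements. -/
theorem finite_deg_dvd {n : ℕ} (hn : n ≠ 0) : {x : ClosedPoint p d | deg x ∣ n}.Finite := by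
  have h1 : Finite (Σ x : ClosedPoint p d, residue x →ₐ[ZMod p] GaloisField p n) :=
    Finite.of_injective _ torusPoint_injective
  refine (Set.finite_range (Sigma.fst : (Σ x : ClosedPoint p d,
    residue x →ₐ[ZMod p] GaloisField p n) → _)).subset fun x hx => ?_
  obtain ⟨φ⟩ := FiniteField.nonempty_algHom_iff_finrank_dvd.2
    (show Module.finrank (ZMod p) (residue x) ∣ Module.finrank (ZMod p) (GaloisField p n) by
      rw [GaloisField.finrank p hn]; exact hx)
  exact ⟨⟨x, φ⟩, rfl⟩

/-- A sum over the points of the torus over the finite field `K` as a sum over closed points: a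
closed point `x` lies under `deg x` points if `deg x` divides the degree of `K`, and under none
otherwise. -/
theorem sum_torusPoint [Finite K] [Fintype Kˣ] {B : Type*} [AddCommMonoid B]
    (s : Finset (ClosedPoint p d))
    (hs : ∀ x, deg x ∣ Module.finrank (ZMod p) K → x ∈ s) (g : (Fin d → Kˣ) → B)
    (c : ClosedPoint p d → B)
    (hc : ∀ x (φ : residue x →ₐ[ZMod p] K), g (torusPoint ⟨x, φ⟩) = c x) :
    ∑ v, g v = ∑ x ∈ s, if deg x ∣ Module.finrank (ZMod p) K then deg x • c x else 0 := by
  have hfin : ∀ x : ClosedPoint p d, Fintype (residue x →ₐ[ZMod p] K) := fun x => Fintype.ofFinite _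
  have h1 : ∀ x ∈ s, (if deg x ∣ Module.finrank (ZMod p) K then deg x • c x else 0) =
      ∑ φ : residue x →ₐ[ZMod p] K, g (torusPoint ⟨x, φ⟩) := fun x _ => by
    simp only [hc]
    rw [Finset.sum_const, Finset.card_univ, Fintype.card_eq_nat_card]
    split_ifs with h
    · rw [FiniteField.natCard_algHom_of_finrank_dvd h]
      rfl
    · have : IsEmpty (residue x →ₐ[ZMod p] K) := ⟨fun φ => h (deg_dvd_of_algHom φ)⟩
      rw [Nat.card_of_isEmpty, zero_smul]
  rw [Finset.sum_congr rfl h1, Finset.sum_sigma']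
  symm
  refine Finset.sum_bij (fun y _ => torusPoint y) (fun _ _ => Finset.mem_univ _)
    (fun _ _ _ _ h => torusPoint_injective h) (fun v _ => ?_) fun _ _ => rfl
  obtain ⟨y, rfl⟩ := torusPoint_surjective (p := p) v
  exact ⟨y, Finset.mem_sigma.2 ⟨hs _ (deg_dvd_of_algHom y.2), Finset.mem_univ _⟩, rfl⟩

/-- The Teichmüller character, with values in `Λ ⊗ W(K)`. -/
def teichUnits (p : ℕ) [Fact p.Prime] (Λ K : Type*) [CommRing Λ] [Algebra ℤ_[p] Λ] [Field K]
    [Algebra (ZMod p) K] : Kˣ →* Λ ⊗[ℤ_[p]] WittVector p K :=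
  (Algebra.TensorProduct.includeRight.toRingHom.toMonoidHom.comp
    (WittVector.teichmuller p)).comp (Units.coeHom K)

/-- Orthogonality for the Teichmüller character. The sum is computed in the domain `W(K)`, and
mapped to `Λ ⊗ W(K)`, which need not be a domain. -/
theorem sum_teichUnits_pow {Λ : Type*} [CommRing Λ] [Algebra ℤ_[p] Λ] [Fintype Kˣ] [Finite K]
    (e : ℕ) : ∑ g, teichUnits p Λ K g ^ e =
      if Fintype.card Kˣ ∣ e then (Fintype.card Kˣ : Λ ⊗[ℤ_[p]] WittVector p K) else 0 := by
  classical
  have : CharP K p := charP_of_injective_algebraMap (algebraMap (ZMod p) K).injective p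
  let τ : Kˣ →* WittVector p K :=
    ((WittVector.teichmuller p).comp (Units.coeHom K)).comp (powMonoidHom e)
  have hτ : τ = 1 ↔ Fintype.card Kˣ ∣ e := by
    rw [← Nat.card_eq_fintype_card, ← IsCyclic.exponent_eq_card,
      Monoid.exponent_dvd_iff_forall_pow_eq_one]
    constructor
    · intro h g
      have h1 := congrArg (fun w => WittVector.coeff w 0) (DFunLike.congr_fun h g)
      refine Units.ext ?_
      change (WittVector.teichmuller p ((g ^ e : Kˣ) : K)).coeff 0 =
        (1 : WittVector p K).coeff 0 at h1
      rwa [WittVector.teichmuller_coeff_zero, WittVector.one_coeff_zero] at h1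
    · intro h
      refine MonoidHom.ext fun g => ?_
      change WittVector.teichmuller p ((g ^ e : Kˣ) : K) = 1
      rw [h g, Units.val_one, map_one]
  have h := congrArg (Algebra.TensorProduct.includeRight :
    WittVector p K →ₐ[ℤ_[p]] Λ ⊗[ℤ_[p]] WittVector p K) (sum_hom_units τ)
  rw [map_sum] at h
  have h2 : ∀ g, (Algebra.TensorProduct.includeRight :
      WittVector p K →ₐ[ℤ_[p]] Λ ⊗[ℤ_[p]] WittVector p K) (τ g) = teichUnits p Λ K g ^ e :=
    fun g => by
      rw [← map_pow]
      rfl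
  simp only [h2] at h
  rw [h]
  by_cases h3 : τ = 1
  · rw [if_pos h3, if_pos (hτ.1 h3), map_natCast]
  · rw [if_neg h3, if_neg fun h4 => h3 (hτ.2 h4), Nat.cast_zero, map_zero]

/-- The coefficients of the logarithmic derivative of the product of the local determinants, in
terms of the Dwork matrix. Only closed points of degree dividing `n` contribute to the coefficient
of `T ^ n`, so the sum is over any finite set `s` containing these. -/
theorem sum_coeff_logDeriv_localFactor {Λ : Type*} [CommRing Λ] [Algebra ℤ_[p] Λ]
    [Module.Flat ℤ_[p] Λ] {u : ℕ} {r : Matrix (Fin m) (Fin m) (MvPolynomial (Fin d) Λ)}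
    (hr : ∀ i j, (∏ k, MvPolynomial.X k) ∣ r i j)
    (hu : ∀ i j, (r i j).totalDegree < (p - 1) * u)
    {E : ClosedPoint p d → (PowerSeries Λ)ˣ}
    (hE : ∀ x, PowerSeries.map (Algebra.TensorProduct.includeLeftRingHom : Λ →+* WittTensor Λ x)
      (E x : PowerSeries Λ) = (localDet r x : PowerSeries _)) {n : ℕ} (hn : n ≠ 0)
    {s : Finset (ClosedPoint p d)} (hs : ∀ x, deg x ∣ n → x ∈ s) :
    ∑ x ∈ s, PowerSeries.coeff n (logDeriv (Additive.ofMul (E x))) =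
      -(((p : Λ) ^ n - 1) ^ d * (dworkMatrix p u r ^ n).trace) := by
  classical
  have := Fintype.ofFinite (GaloisField p n)
  have hfr : Module.finrank (ZMod p) (GaloisField p n) = n := GaloisField.finrank p hn
  have hcard : Fintype.card (GaloisField p n)ˣ = p ^ n - 1 := by
    rw [Fintype.card_units, Fintype.card_eq_nat_card, GaloisField.card p n hn]
  have htr := sum_trace_frobProd (teichUnits p Λ (GaloisField p n)) sum_teichUnits_pow
    hp.out.one_lt hr hu hn hcard
  let ι : Λ →+* Λ ⊗[ℤ_[p]] WittVector p (GaloisField p n) :=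
    Algebra.TensorProduct.includeLeftRingHom
  -- both sides are compared in `Λ ⊗ W(𝔽_(p^n))`, where the trace formula holds
  refine includeLeft_witt_injective (p := p) (k := GaloisField p n) ?_
  change ι _ = ι _
  refine Eq.trans ?_ ((congrArg Neg.neg htr).trans (map_neg ι _).symm)
  have hc : ∀ x : ClosedPoint p d, ∃ c : Λ, deg x ∣ n →
      Algebra.TensorProduct.includeLeftRingHom c = (teichProd p r n (coord x)).trace := fun x => by
    by_cases h : deg x ∣ n
    · obtain ⟨c, hc⟩ := exists_trace_teichProd r x hn h
      exact ⟨c, fun _ => hc⟩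
    · exact ⟨0, fun h' => absurd h' h⟩
  choose c hc using hc
  -- the trace at a point over `x` does not depend on the embedding of the residue field of `x`,
  -- since it comes from `Λ`
  rw [sum_torusPoint (p := p) s (fun x hx => hs x (hfr ▸ hx)) _ (fun x => ι (c x)) ?_, map_sum,
    ← Finset.sum_neg_distrib]
  · refine Finset.sum_congr rfl fun x _ => ?_
    have h1 := coeff_logDeriv_localFactor r x (hE x) hn
    have h2 : PowerSeries.coeff n (logDeriv (Additive.ofMul (E x))) =
        -if deg x ∣ n then deg x • c x else 0 := by
      refine includeLeft_witt_injective (p := p) (k := residue x) (h1.trans ?_)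
      rw [map_neg]
      congr 1
      split_ifs with h
      · rw [nsmul_eq_mul, map_mul, map_natCast, hc x h]
      · rw [map_zero]
    rw [h2, map_neg, hfr]
    split_ifs
    · rw [map_nsmul]
    · rw [map_zero]
  · intro x φ
    have hdvd : deg x ∣ n := hfr ▸ deg_dvd_of_algHom φ
    have h1 := congrArg (wittTensorMap Λ φ) (hc x hdvd)
    have h2 := AddMonoidHom.map_trace (wittTensorMap Λ φ).toRingHom.toAddMonoidHom
      (teichProd p r n (coord x))
    have h3 : wittTensorMap Λ φ (Algebra.TensorProduct.includeLeftRingHom (c x)) = ι (c x) := by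
      exact (wittTensorMap Λ φ).commutes (c x)
    rw [← h3, h1]
    refine Eq.trans ?_ h2.symm
    refine congrArg Matrix.trace ?_
    refine Eq.trans ?_ (teichProd_map r φ n (coord x)).symm
    rfl

end TorusPoints

/-! ### The Euler product -/

section EulerProduct

/-- `Λ` is torsion-free, so that logarithmic derivatives determine elements of `1 + T Λ⟦T⟧`. -/
theorem isAddTorsionFree_of_flat (p : ℕ) [Fact p.Prime] (Λ : Type*) [CommRing Λ] [Algebra ℤ_[p] Λ]
    [Module.Finite ℤ_[p] Λ] [Module.Flat ℤ_[p] Λ] : IsAddTorsionFree Λ := by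
  have : Module.Free ℤ_[p] Λ := Module.free_of_flat_of_isLocalRing
  refine ⟨fun n hn a b hab => ?_⟩
  have h : (n : ℤ_[p]) • a = (n : ℤ_[p]) • b := by
    simpa only [Nat.cast_smul_eq_nsmul] using hab
  exact smul_right_injective Λ (Nat.cast_ne_zero.2 hn) h

/-- If `p` were a unit of `Λ`, then `Λ = p Λ` would be zero by Nakayama's lemma over `ℤ_p`. -/
theorem natCast_mem_maximalIdeal (p : ℕ) [Fact p.Prime] (Λ : Type*) [CommRing Λ] [IsLocalRing Λ]
    [Algebra ℤ_[p] Λ] [Module.Finite ℤ_[p] Λ] :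
    (p : Λ) ∈ IsLocalRing.maximalIdeal Λ := by
  rw [IsLocalRing.mem_maximalIdeal]
  intro hunit
  refine one_ne_zero (α := Λ) ?_
  have h := Submodule.eq_bot_of_le_smul_of_le_jacobson_bot (IsLocalRing.maximalIdeal ℤ_[p])
    (⊤ : Submodule ℤ_[p] Λ) Module.Finite.fg_top (fun a _ => ?_)
    (IsLocalRing.maximalIdeal_le_jacobson _)
  · exact (Submodule.mem_bot ℤ_[p]).1 (h ▸ Submodule.mem_top)
  · obtain ⟨b, hb⟩ := hunit.dvd (a := a)
    have hb' : a = (p : ℤ_[p]) • b := by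
      rw [hb, Nat.cast_smul_eq_nsmul, nsmul_eq_mul]
    rw [hb']
    refine Submodule.smul_mem_smul ?_ Submodule.mem_top
    rw [IsLocalRing.mem_maximalIdeal]
    exact PadicInt.p_nonunit

variable {R : Type*} [CommRing R]

/-- The group `1 + T R⟦T⟧`, as the kernel of the constant coefficient on the units of `R⟦T⟧`. -/
def oneUnits (R : Type*) [CommRing R] : Subgroup (PowerSeries R)ˣ :=
  (Units.map (PowerSeries.constantCoeff (R := R)).toMonoidHom).ker

theorem mem_oneUnits {F : (PowerSeries R)ˣ} :
    F ∈ oneUnits R ↔ PowerSeries.constantCoeff (F : PowerSeries R) = 1 := by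
  rw [oneUnits, MonoidHom.mem_ker, Units.ext_iff]
  rfl

/-- The group of quotients of polynomials with constant coefficient `1`. -/
def rationalUnits (R : Type*) [CommRing R] : Subgroup (PowerSeries R)ˣ where
  carrier := {F | ∃ A B : Polynomial R, A.coeff 0 = 1 ∧ B.coeff 0 = 1 ∧
    (F : PowerSeries R) * (B : PowerSeries R) = (A : PowerSeries R)}
  one_mem' := ⟨1, 1, by simp, by simp, by simp⟩
  mul_mem' := by
    rintro F G ⟨A, B, hA, hB, h⟩ ⟨A', B', hA', hB', h'⟩
    refine ⟨A * A', B * B', by rw [Polynomial.mul_coeff_zero, hA, hA', one_mul],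
      by rw [Polynomial.mul_coeff_zero, hB, hB', one_mul], ?_⟩
    rw [Polynomial.coe_mul, Polynomial.coe_mul, ← h, ← h', Units.val_mul]
    ring
  inv_mem' := by
    rintro F ⟨A, B, hA, hB, h⟩
    exact ⟨B, A, hB, hA, by rw [← h, ← mul_assoc, Units.inv_mul, one_mul]⟩

theorem coeff_logDeriv_zpow (F : (PowerSeries R)ˣ) (z : ℤ) (n : ℕ) :
    PowerSeries.coeff n (logDeriv (Additive.ofMul (F ^ z))) =
      z * PowerSeries.coeff n (logDeriv (Additive.ofMul F)) := by
  rw [ofMul_zpow, map_zsmul, map_zsmul, zsmul_eq_mul]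

theorem coeff_logDeriv_prod {ι : Type*} (s : Finset ι) (F : ι → (PowerSeries R)ˣ) (n : ℕ) :
    PowerSeries.coeff n (logDeriv (Additive.ofMul (∏ i ∈ s, F i))) =
      ∑ i ∈ s, PowerSeries.coeff n (logDeriv (Additive.ofMul (F i))) := by
  rw [ofMul_prod, map_sum, map_sum]

open scoped PowerSeries.WithPiTopology in
/-- A family of elements of `1 + T R⟦T⟧` over a torsion-free ring `R` has product `L` if, in each
degree, the logarithmic derivatives of its large finite subproducts are that of `L`. -/
theorem hasTadicProd_of_logDeriv [IsAddTorsionFree R] {ι : Type*} {F : ι → (PowerSeries R)ˣ}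
    {L : (PowerSeries R)ˣ} (hF : ∀ x, F x ∈ oneUnits R) (hL : L ∈ oneUnits R)
    (h : ∀ n, n ≠ 0 → ∀ᶠ s : Finset ι in Filter.atTop,
      ∑ x ∈ s, PowerSeries.coeff n (logDeriv (Additive.ofMul (F x))) =
        PowerSeries.coeff n (logDeriv (Additive.ofMul L))) :
    HasTadicProd (fun x => (F x : PowerSeries R)) (L : PowerSeries R) := by
  let _ : TopologicalSpace R := ⊥
  have : DiscreteTopology R := ⟨rfl⟩
  rw [HasTadicProd, HasProd, PowerSeries.WithPiTopology.tendsto_iff_coeff_tendsto]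
  intro N
  refine tendsto_nhds_of_eventually_eq ?_
  have h1 : ∀ᶠ s : Finset ι in Filter.atTop, ∀ n ∈ Finset.range (N + 1), n ≠ 0 →
      ∑ x ∈ s, PowerSeries.coeff n (logDeriv (Additive.ofMul (F x))) =
        PowerSeries.coeff n (logDeriv (Additive.ofMul L)) := by
    rw [Filter.eventually_all_finset]
    intro n _
    by_cases hn : n = 0
    · exact Filter.Eventually.of_forall fun s h0 => absurd hn h0
    · exact (h n hn).mono fun s hs _ => hs
  rw [SummationFilter.unconditional_filter]
  filter_upwards [h1] with s hs
  rw [← Units.coe_prod]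
  refine coeff_eq_of_coeff_logDeriv_eq (N := N) (mem_oneUnits.1 (prod_mem fun x _ => hF x))
    (mem_oneUnits.1 hL) (fun n hn hn0 => ?_) N le_rfl
  rw [coeff_logDeriv_prod]
  exact hs n (Finset.mem_range.2 (Nat.lt_succ_of_le hn)) hn0

/-- The series `h(p T)`, for `h ∈ 1 + T R⟦T⟧`, lies in `1 + p T R⟨T⟩` if `p` is in the maximal
ideal. -/
theorem exists_isRestricted [IsLocalRing R] {p : R} (hp : p ∈ IsLocalRing.maximalIdeal R)
    {F : (PowerSeries R)ˣ}
    (hF : F ∈ (oneUnits R).map (Units.map (PowerSeries.rescale p).toMonoidHom)) :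
    ∃ g : PowerSeries R, IsRestricted g ∧
      (F : PowerSeries R) = 1 + PowerSeries.C p * PowerSeries.X * g := by
  obtain ⟨h, hh, rfl⟩ := hF
  obtain ⟨g, hg⟩ : (PowerSeries.X : PowerSeries R) ∣ (h : PowerSeries R) - 1 := by
    rw [PowerSeries.X_dvd_iff, map_sub, mem_oneUnits.1 hh, map_one, sub_self]
  refine ⟨PowerSeries.rescale p g, fun N => ?_, ?_⟩
  · refine Filter.eventually_atTop.2 ⟨N, fun n hn => ?_⟩
    rw [PowerSeries.coeff_rescale]
    exact Ideal.mul_mem_right _ _ (Ideal.pow_le_pow_right hn (Ideal.pow_mem_pow hp n))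
  · change PowerSeries.rescale p (h : PowerSeries R) = _
    rw [← PowerSeries.rescale_X, ← map_mul, ← hg, map_sub, map_one, add_sub_cancel]

/-- The binomial expansion of `(q - 1)^d t`, with the exponents of the formula for the `L`-function;
`q` stands for `p ^ n`, and `-t` for the coefficient of `T ^ n` in the logarithmic derivative of
`P`. -/
theorem sum_binomial_eq (q t : R) (d : ℕ) :
    ∑ i ∈ Finset.range (d + 1), ((((-1 : ℤ) ^ (d + 1 - i) * (d.choose i : ℤ) : ℤ)) : R) *
      (q ^ i * -t) = (q - 1) ^ d * t := by
  rw [sub_eq_add_neg, add_pow, Finset.sum_mul]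
  refine Finset.sum_congr rfl fun i hi => ?_
  have h1 : d + 1 - i = (d - i) + 1 := by
    have := Finset.mem_range.1 hi
    omega
  rw [h1, pow_succ]
  push_cast
  ring

end EulerProduct

end UnitLFunction

end

open UnitLFunction in
theorem proposition4p16 (p : ℕ) [Fact p.Prime] (d m : ℕ) (hd : 0 < d)
    (Λ : Type*) [CommRing Λ] [IsLocalRing Λ] [Algebra ℤ_[p] Λ] [Module.Finite ℤ_[p] Λ]
    [Module.Flat ℤ_[p] Λ]
    (r : Matrix (Fin m) (Fin m) (MvPolynomial (Fin d) Λ))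
    (hr : ∀ i j, (∏ k, MvPolynomial.X k) ∣ r i j)
    (u : ℤ) (hu : ∀ i j, ((r i j).totalDegree : ℤ) < (p - 1) * u)
    (P : Polynomial Λ) (hP : P = UnitLFunction.charSeries r hu) :
    -- the module `H^d` is finite free, and `P(T) ∈ 1 + T Λ[T]`
    Module.Finite Λ (UnitLFunction.cohomology p d m Λ u d) ∧
    Module.Free Λ (UnitLFunction.cohomology p d m Λ u d) ∧
    P.coeff 0 = 1 ∧
    -- the local determinants have coefficients in `Λ`, embedded in `Λ ⊗ W_x` by `a ↦ a ⊗ 1`; the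
    -- local determinants and the series `P(p^i T)` are units `E x` and `Q i` of `Λ⟦T⟧`
    (∀ x : UnitLFunction.ClosedPoint p d, Function.Injective
      (Algebra.TensorProduct.includeLeftRingHom : Λ →+* UnitLFunction.WittTensor Λ x)) ∧
    ∃ (E : UnitLFunction.ClosedPoint p d → (PowerSeries Λ)ˣ) (Q : ℕ → (PowerSeries Λ)ˣ),
      (∀ x, PowerSeries.map
        (Algebra.TensorProduct.includeLeftRingHom : Λ →+* UnitLFunction.WittTensor Λ x)
          (E x : PowerSeries Λ) = (UnitLFunction.localDet r x : PowerSeries _)) ∧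
      (∀ i, (Q i : PowerSeries Λ) = PowerSeries.rescale ((p : Λ) ^ i) (P : PowerSeries Λ)) ∧
      -- `L` is the product of the inverses of the local determinants over all closed points
      ∃ L : (PowerSeries Λ)ˣ,
        UnitLFunction.HasTadicProd (fun x => ((E x)⁻¹ : (PowerSeries Λ)ˣ).val) L.val ∧
        L = ∏ i ∈ Finset.range (d + 1), Q i ^ ((-1 : ℤ) ^ (d + 1 - i) * (d.choose i : ℤ)) ∧
        -- the ratio `L / P(T)^((-1)^(d+1))` lies in `1 + p T Λ⟨T⟩` and is a rational function
        (∃ g : PowerSeries Λ, UnitLFunction.IsRestricted g ∧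
          (L / Q 0 ^ ((-1 : ℤ) ^ (d + 1))).val =
            1 + PowerSeries.C (p : Λ) * PowerSeries.X * g) ∧
        ∃ A B : Polynomial Λ, B.coeff 0 = 1 ∧
          (L / Q 0 ^ ((-1 : ℤ) ^ (d + 1))).val * (B : PowerSeries Λ) = (A : PowerSeries Λ) := by
  have hp : p.Prime := Fact.out
  have htf := isAddTorsionFree_of_flat p Λ
  have hu' : ∀ i j, (r i j).totalDegree < (p - 1) * u.toNat := fun i j => by
    have h1 := hu i j
    have h2 : (0 : ℤ) ≤ p - 1 := by have := hp.one_lt; omega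
    have h3 : (p - 1) * u ≤ ((p : ℤ) - 1) * u.toNat :=
      mul_le_mul_of_nonneg_left (Int.self_le_toNat u) h2
    zify [hp.one_lt.le]
    exact h1.trans_le h3
  have hbasis := toMatrix_cohomologyMap hd hr hu hu'
  set b := Module.Basis.ofEquivFun (cohomologyEquiv (p := p) (m := m) (Λ := Λ) (u := u) hd)
  set A := dworkMatrix p u.toNat r
  have hPA : (P : PowerSeries Λ) = revCharpoly 1 A := by
    rw [hP, charSeries, coe_detOneSub b, hbasis]
  have hP1 : PowerSeries.constantCoeff (P : PowerSeries Λ) = 1 := by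
    rw [hPA, constantCoeff_revCharpoly one_pos]
  have hP0 : P.coeff 0 = 1 := by
    rw [← Polynomial.coeff_coe, PowerSeries.coeff_zero_eq_constantCoeff, hP1]
  have hQ1 : ∀ i, PowerSeries.constantCoeff
      (PowerSeries.rescale ((p : Λ) ^ i) (P : PowerSeries Λ)) = 1 := fun i => by
    rw [← PowerSeries.coeff_zero_eq_constantCoeff, PowerSeries.coeff_rescale, pow_zero, one_mul,
      PowerSeries.coeff_zero_eq_constantCoeff, hP1]
  have hQ : ∀ i, ∃ Q : (PowerSeries Λ)ˣ,
      (Q : PowerSeries Λ) = PowerSeries.rescale ((p : Λ) ^ i) (P : PowerSeries Λ) := fun i =>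
    PowerSeries.isUnit_iff_constantCoeff.2 (hQ1 i ▸ isUnit_one)
  choose Q hQ using hQ
  choose E hE hE1 using fun x : ClosedPoint p d => exists_localFactor r x
  have hQmem : ∀ i, Q i ∈ oneUnits Λ := fun i => mem_oneUnits.2 (by rw [hQ, hQ1])
  have hQ0 : (Q 0 : PowerSeries Λ) = revCharpoly 1 A := by
    rw [hQ, pow_zero, PowerSeries.rescale_one, RingHom.id_apply, hPA]
  have hQrat : ∀ i, Q i ∈ rationalUnits Λ := fun i => by
    refine ⟨P.comp (Polynomial.C ((p : Λ) ^ i) * Polynomial.X), 1, ?_, by simp, ?_⟩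
    · rw [Polynomial.comp_C_mul_X_coeff, hP0, pow_zero, one_mul]
    · rw [hQ, Polynomial.coe_one, mul_one]
      ext n
      rw [PowerSeries.coeff_rescale, Polynomial.coeff_coe, Polynomial.coeff_coe,
        Polynomial.comp_C_mul_X_coeff, mul_comm]
  have hQsucc : ∀ i, Q (i + 1) ∈
      (oneUnits Λ).map (Units.map (PowerSeries.rescale (p : Λ)).toMonoidHom) := fun i => by
    -- `P(p ^ (i + 1) T)` is the value of `P(p ^ i T)` at `p T`
    refine ⟨Q i, hQmem i, Units.ext ?_⟩
    change PowerSeries.rescale (p : Λ) (Q i : PowerSeries Λ) = Q (i + 1)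
    rw [hQ, hQ, PowerSeries.rescale_rescale, pow_succ]
  set L : (PowerSeries Λ)ˣ :=
    ∏ i ∈ Finset.range (d + 1), Q i ^ ((-1 : ℤ) ^ (d + 1 - i) * (d.choose i : ℤ)) with hL
  have hratio : L / Q 0 ^ ((-1 : ℤ) ^ (d + 1)) =
      ∏ i ∈ Finset.range d,
        Q (i + 1) ^ ((-1 : ℤ) ^ (d + 1 - (i + 1)) * (d.choose (i + 1) : ℤ)) := by
    rw [hL, Finset.prod_range_succ', Nat.sub_zero, Nat.choose_zero_right, Nat.cast_one, mul_one,
      mul_div_cancel_right]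
  refine ⟨Module.Finite.of_basis b, Module.Free.of_basis b, hP0,
    fun x => includeLeft_witt_injective (p := p) (k := residue x), E, Q, hE, hQ, L, ?_, hL, ?_, ?_⟩
  · refine hasTadicProd_of_logDeriv (F := fun x => (E x)⁻¹)
      (fun x => inv_mem (mem_oneUnits.2 (hE1 x)))
      (prod_mem fun i _ => zpow_mem (hQmem i) _) fun n hn => ?_
    filter_upwards [Filter.eventually_ge_atTop (finite_deg_dvd (p := p) (d := d) hn).toFinset]
      with s hs
    have h1 := sum_coeff_logDeriv_localFactor hr hu' hE hn (s := s)
      fun x hx => hs ((Set.Finite.mem_toFinset _).2 hx)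
    have h2 : ∀ i, PowerSeries.coeff n (logDeriv (Additive.ofMul (Q i))) =
        ((p : Λ) ^ n) ^ i * -(A ^ n).trace := fun i => by
      rw [coeff_logDeriv_rescale ((p : Λ) ^ i) (F := Q 0) (by
        rw [hQ i, hQ 0, pow_zero, PowerSeries.rescale_one, RingHom.id_apply]),
        coeff_logDeriv_revCharpoly one_pos hQ0 hn, if_pos (one_dvd n), Nat.cast_one, one_mul,
        Nat.div_one, pow_right_comm]
    rw [hL, coeff_logDeriv_prod]
    simp only [coeff_logDeriv_zpow, h2, ofMul_inv, map_neg, Finset.sum_neg_distrib]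
    rw [h1, neg_neg, sum_binomial_eq]
  · rw [hratio]
    exact exists_isRestricted (natCast_mem_maximalIdeal p Λ)
      (prod_mem fun i _ => zpow_mem (hQsucc i) _)
  · obtain ⟨A', B, -, hB, h⟩ : L / Q 0 ^ ((-1 : ℤ) ^ (d + 1)) ∈ rationalUnits Λ :=
      div_mem (prod_mem fun i _ => zpow_mem (hQrat i) _) (zpow_mem (hQrat 0) _)
    exact ⟨A', B, hB, h⟩
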